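/- Fix a field $\mathbb K$ and a homology degree $k\ge 0$. Let $X$ be a finitely triangulable space (homeomorphic to the underlying space of a finite simplicial complex). Call $\Phi=(f,g):X\to\mathbb R^2$ *admissible* if it is continuous and, for every degree and every $u\in\mathbb R^2$, the Čech homology over $\mathbb K$ of the sublevel set $\{x:\Phi(x)\le u\}$ (componentwise order) is finite dimensional. For real functions $\varphi,\psi$ on $X$ let $d_B(\varphi,\psi)\in[0,\infty]$ be the bottleneck distance between the $k$-th persistence diagrams of their sublevel set filtrations (defined by the persistent Betti numbers in Čech homology). For $(a,b)\in[0,1]\times\mathbb R$ put $$\Phi_{(a,b)}=\min\{a,1-a\}\cdot\max\Big\{\frac{f-b}{a},\frac{g+b}{1-a}\Big\}\quad(0<a<1),\qquad \Phi_{(0,b)}=\max\{f-b,0\},\qquad \Phi_{(1,b)}=\max\{0,g+b\},$$ and let the matching distance (with horizontal and vertical lines included) be $d_{match}(\Phi_1,\Phi_2)=\sup_{(a,b)\in[0,1]\times\mathbb R}d_B\big((\Phi_1)_{(a,b)},(\Phi_2)_{(a,b)}\big)$. For $\Phi_i=(f_i,g_i)$ define the topological difference $$\Delta(\Phi_1,\Phi_2)=d_{match}(\Phi_1,\Phi_2)-\max\{d_B(f_1,f_2),d_B(g_1,g_2)\}.$$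 For $\Phi=(f,g)$, with $F=(f,f)$ and $G=(g,g)$, define the topological correlation $$\Delta(\Phi)=\frac{2\max\{\Delta(\Phi,F),\Delta(\Phi,G)\}}{\Delta(\Phi,F)+\Delta(\Phi,G)}-1\ \text{ if }\ \Delta(\Phi,F)+\Delta(\Phi,G)\ne0,\qquad \Delta(\Phi)=1\ \text{ otherwise.}$$ Then: - For all admissible $\Phi_1=(f_1,g_1)$, $\Phi_2=(f_2,g_2)$ on $X$, the distances $d_B(f_1,f_2)$, $d_B(g_1,g_2)$, $d_{match}(\Phi_1,\Phi_2)$ are finite and $\Delta(\Phi_1,\Phi_2)\ge 0$. - For every admissible $\Phi=(f,g)$, $\Delta(\Phi)\in[0,1]$. - (1) If $\Phi=(f,f)$ is admissible, then $\Delta(\Phi)=1$. - (2) For admissible $\Phi=(f,g)$: $\Delta(\Phi)=0$ if and only if $\Delta(\Phi,F)=\Delta(\Phi,G)\neq0$. - (3) For admissible $\Phi=(f,g)$: if $d_{match}(\Phi,F)=d_B(f,g)=d_{match}(\Phi,G)$, then $\Delta(\Phi)=1$. More precisely, $\Delta(\Phi)=1$ if and only if $d_{match}(\Phi,F)=d_B(f,g)$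 or $d_{match}(\Phi,G)=d_B(f,g)$. - In (3), "or" cannot be replaced by "and": over every field and in degree $k=0$ there are a finitely triangulable space $X$ and an admissible $\Phi=(f,g)$ on it with $\Delta(\Phi)=1$ and $d_{match}(\Phi,F)=d_B(f,g)\neq d_{match}(\Phi,G)$. -/

import Mathlib

open scoped ENNReal

noncomputable section

namespace TopCorr

/-! ### Finite open covers, their nerves and the homology of the nerves -/

/-- A finite (indexed) open cover of a topological space. -/
structure FinOpenCover (X : Type*) [TopologicalSpace X] where
  /-- the number of members -/
  n : ℕ
  /-- the members -/
  U : Fin n → Set X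
  isOpen : ∀ i, IsOpen (U i)
  covers : ∀ x, ∃ i, x ∈ U i

namespace FinOpenCover

/-- The preimage of a finite open cover under a continuous map, with the same index set. -/
def comap {X Y : Type*} [TopologicalSpace X] [TopologicalSpace Y] (f : C(X, Y))
    (V : FinOpenCover Y) : FinOpenCover X where
  n := V.n
  U := fun i => f ⁻¹' V.U i
  isOpen := fun i => (V.isOpen i).preimage f.continuous
  covers := fun x => V.covers (f x)

end FinOpenCover

section Nerve

variable {X Y Z : Type*} [TopologicalSpace X] [TopologicalSpace Y] [TopologicalSpace Z]

/-- The ordered `k`-simplices of the nerve of a cover: `(k+1)`-tuples of indices whose members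
have a common point. -/
def NerveSimplex (U : FinOpenCover X) (k : ℕ) : Type :=
  {s : Fin (k + 1) → Fin U.n // ∃ x, ∀ j, x ∈ U.U (s j)}

/-- The `i`-th face of an ordered simplex (drop the `i`-th vertex). -/
def NerveSimplex.face {U : FinOpenCover X} {k : ℕ} (i : Fin (k + 2))
    (s : NerveSimplex U (k + 1)) : NerveSimplex U k :=
  ⟨fun j => s.1 (i.succAbove j), s.2.imp fun _ hx j => hx (i.succAbove j)⟩

/-- An index map `p` from `U` to `V` is carried by `f : X → Y` if `f (U i) ⊆ V (p i)` for all `i`.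
For `f = id` this says that `U` refines `V` through `p`. -/
def Carries (f : X → Y) (U : FinOpenCover X) (V : FinOpenCover Y)
    (p : Fin U.n → Fin V.n) : Prop :=
  ∀ i, ∀ x ∈ U.U i, f x ∈ V.U (p i)

/-- The map on ordered simplices of nerves induced by a carried index map. -/
def NerveSimplex.map {f : X → Y} {U : FinOpenCover X} {V : FinOpenCover Y}
    {p : Fin U.n → Fin V.n} (h : Carries f U V p) (k : ℕ)
    (s : NerveSimplex U k) : NerveSimplex V k :=
  ⟨fun j => p (s.1 j), s.2.elim fun x hx => ⟨f x, fun j => h _ _ (hx j)⟩⟩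

variable (𝕂 : Type*) [Field 𝕂]

/-- Ordered simplicial `k`-chains of the nerve. -/
def NerveChain (U : FinOpenCover X) (k : ℕ) : Type _ := NerveSimplex U k →₀ 𝕂

instance (U : FinOpenCover X) (k : ℕ) : AddCommGroup (NerveChain 𝕂 U k) :=
  inferInstanceAs (AddCommGroup (NerveSimplex U k →₀ 𝕂))

instance (U : FinOpenCover X) (k : ℕ) : Module 𝕂 (NerveChain 𝕂 U k) :=
  inferInstanceAs (Module 𝕂 (NerveSimplex U k →₀ 𝕂))

/-- The linear map on chains that extends a map of ordered simplices. -/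
def pushChain {U : FinOpenCover X} {V : FinOpenCover Y} {k l : ℕ}
    (m : NerveSimplex U k → NerveSimplex V l) : NerveChain 𝕂 U k →ₗ[𝕂] NerveChain 𝕂 V l :=
  Finsupp.lmapDomain 𝕂 𝕂 m

theorem pushChain_pushChain {U : FinOpenCover X} {V : FinOpenCover Y} {W : FinOpenCover Z}
    {k l r : ℕ} (m : NerveSimplex U k → NerveSimplex V l)
    (m' : NerveSimplex V l → NerveSimplex W r) (c : NerveChain 𝕂 U k) :
    pushChain 𝕂 m' (pushChain 𝕂 m c) = pushChain 𝕂 (m' ∘ m) c :=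
  (Finsupp.mapDomain_comp (f := m) (g := m') (v := c)).symm

/-- The boundary operator `∂ s = ∑ i, (-1)^i • (i-th face of s)` from `(k+1)`-chains to
`k`-chains. -/
def boundary (U : FinOpenCover X) (k : ℕ) : NerveChain 𝕂 U (k + 1) →ₗ[𝕂] NerveChain 𝕂 U k :=
  ∑ i : Fin (k + 2), (-1 : 𝕂) ^ (i : ℕ) • pushChain 𝕂 (NerveSimplex.face i)

/-- The `k`-cycles of the nerve. -/
def cycles (U : FinOpenCover X) : (k : ℕ) → Submodule 𝕂 (NerveChain 𝕂 U k)
  | 0 => ⊤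
  | k + 1 => LinearMap.ker (boundary 𝕂 U k)

/-- The `k`-boundaries of the nerve, as a subspace of the `k`-cycles. -/
def boundaries (U : FinOpenCover X) (k : ℕ) : Submodule 𝕂 (cycles 𝕂 U k) :=
  (LinearMap.range (boundary 𝕂 U k)).comap (cycles 𝕂 U k).subtype

/-- The `k`-th simplicial homology of the nerve of `U` with coefficients in `𝕂`. -/
abbrev NerveHomology (k : ℕ) (U : FinOpenCover X) : Type _ :=
  (cycles 𝕂 U k) ⧸ (boundaries 𝕂 U k)

/-- The map on chains induced by a carried index map. -/
def chainMap {f : X → Y} {U : FinOpenCover X} {V : FinOpenCover Y}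
    {p : Fin U.n → Fin V.n} (h : Carries f U V p) (k : ℕ) :
    NerveChain 𝕂 U k →ₗ[𝕂] NerveChain 𝕂 V k :=
  pushChain 𝕂 (NerveSimplex.map h k)

theorem boundary_chainMap {f : X → Y} {U : FinOpenCover X} {V : FinOpenCover Y}
    {p : Fin U.n → Fin V.n} (h : Carries f U V p) (k : ℕ) (c : NerveChain 𝕂 U (k + 1)) :
    boundary 𝕂 V k (chainMap 𝕂 h (k + 1) c) = chainMap 𝕂 h k (boundary 𝕂 U k c) := by
  simp only [boundary, chainMap, LinearMap.sum_apply, LinearMap.smul_apply, map_sum, map_smul,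
    pushChain_pushChain]
  rfl

theorem chainMap_mem_cycles {f : X → Y} {U : FinOpenCover X} {V : FinOpenCover Y}
    {p : Fin U.n → Fin V.n} (h : Carries f U V p) (k : ℕ) :
    ∀ c ∈ cycles 𝕂 U k, chainMap 𝕂 h k c ∈ cycles 𝕂 V k := by
  intro c hc
  cases k with
  | zero => exact Submodule.mem_top
  | succ k =>
    have hc' : boundary 𝕂 U k c = 0 := hc
    change boundary 𝕂 V k (chainMap 𝕂 h (k + 1) c) = 0
    rw [boundary_chainMap, hc', map_zero]

theorem boundaries_le_comap {f : X → Y} {U : FinOpenCover X} {V : FinOpenCover Y}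
    {p : Fin U.n → Fin V.n} (h : Carries f U V p) (k : ℕ) :
    boundaries 𝕂 U k ≤ (boundaries 𝕂 V k).comap
      ((chainMap 𝕂 h k).restrict (chainMap_mem_cycles 𝕂 h k)) := by
  rintro ⟨c, hc⟩ ⟨d, hd⟩
  exact ⟨chainMap 𝕂 h (k + 1) d, by
    rw [boundary_chainMap, hd]; rfl⟩

/-- The map on homology of nerves induced by a carried index map. -/
def nerveMap {f : X → Y} {U : FinOpenCover X} {V : FinOpenCover Y}
    {p : Fin U.n → Fin V.n} (h : Carries f U V p) (k : ℕ) :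
    NerveHomology 𝕂 k U →ₗ[𝕂] NerveHomology 𝕂 k V :=
  (boundaries 𝕂 U k).mapQ (boundaries 𝕂 V k)
    ((chainMap 𝕂 h k).restrict (chainMap_mem_cycles 𝕂 h k)) (boundaries_le_comap 𝕂 h k)

theorem Carries.comp {f : X → Y} {g : Y → Z} {U : FinOpenCover X} {V : FinOpenCover Y}
    {W : FinOpenCover Z} {p : Fin U.n → Fin V.n} {q : Fin V.n → Fin W.n}
    (hp : Carries f U V p) (hq : Carries g V W q) : Carries (g ∘ f) U W (q ∘ p) :=
  fun i x hx => hq _ _ (hp i x hx)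

theorem nerveMap_nerveMap {f : X → Y} {g : Y → Z} {U : FinOpenCover X} {V : FinOpenCover Y}
    {W : FinOpenCover Z} {p : Fin U.n → Fin V.n} {q : Fin V.n → Fin W.n}
    (hp : Carries f U V p) (hq : Carries g V W q) (k : ℕ) (x : NerveHomology 𝕂 k U) :
    nerveMap 𝕂 hq k (nerveMap 𝕂 hp k x) = nerveMap 𝕂 (hp.comp hq) k x := by
  obtain ⟨⟨c, hc⟩, rfl⟩ := Submodule.Quotient.mk_surjective _ x
  simp only [nerveMap, Submodule.mapQ_apply]
  congr 1
  apply Subtype.ext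
  simp only [LinearMap.coe_restrict_apply, chainMap, pushChain_pushChain]
  rfl

end Nerve

/-! ### Čech homology -/

section Cech

variable (𝕂 : Type*) [Field 𝕂]

/-- The `k`-th Čech homology of a (compact) space `X`: the inverse limit, over all finite open
covers of `X` and all refinements between them, of the homology of the nerves. -/
def CechHomology (k : ℕ) (X : Type*) [TopologicalSpace X] :
    Submodule 𝕂 ((U : FinOpenCover X) → NerveHomology 𝕂 k U) where
  carrier := {x | ∀ (U V : FinOpenCover X) (p : Fin U.n → Fin V.n) (h : Carries id U V p),
    nerveMap 𝕂 h k (x U) = x V}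
  zero_mem' := fun U V p h => by simp
  add_mem' := fun {x y} hx hy U V p h => by simp [hx U V p h, hy U V p h]
  smul_mem' := fun c x hx U V p h => by simp [hx U V p h]

variable {X Y : Type*} [TopologicalSpace X] [TopologicalSpace Y]

/-- The tautological index map from the preimage of a cover `V` to `V`. -/
def comapIndex (f : C(X, Y)) (V : FinOpenCover Y) : Fin (V.comap f).n → Fin V.n := fun i => i

theorem carries_comap (f : C(X, Y)) (V : FinOpenCover Y) :
    Carries f (V.comap f) V (comapIndex f V) :=
  fun _ _ hx => hx

/-- The map on Čech homology induced by a continuous map. -/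
def cechMap (k : ℕ) (f : C(X, Y)) : CechHomology 𝕂 k X →ₗ[𝕂] CechHomology 𝕂 k Y where
  toFun x := ⟨fun V => nerveMap 𝕂 (carries_comap f V) k (x.1 (V.comap f)), by
    intro V W p h
    let p' : Fin (V.comap f).n → Fin (W.comap f).n := p
    have h' : Carries id (V.comap f) (W.comap f) p' := fun i x hx => h i (f x) hx
    have e := x.2 (V.comap f) (W.comap f) p' h'
    show nerveMap 𝕂 h k (nerveMap 𝕂 (carries_comap f V) k (x.1 (V.comap f))) =
      nerveMap 𝕂 (carries_comap f W) k (x.1 (W.comap f))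
    rw [← e, nerveMap_nerveMap, nerveMap_nerveMap]
    rfl⟩
  map_add' x y := by ext V; simp
  map_smul' c x := by ext V; simp

end Cech

/-! ### Persistent Betti numbers and persistence diagrams -/

section Persistence

variable (𝕂 : Type*) [Field 𝕂] (k : ℕ) {X : Type*} [TopologicalSpace X]

/-- The inclusion of sublevel sets of `φ`. -/
def sublevelIncl (φ : X → ℝ) {u v : ℝ} (h : u ≤ v) :
    C({x : X // φ x ≤ u}, {x : X // φ x ≤ v}) where
  toFun x := ⟨x.1, x.2.trans h⟩
  continuous_toFun := continuous_subtype_val.subtype_mk _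

open Classical in
/-- The `k`-th persistent Betti number of `φ` at `(u, v)`, `u ≤ v`: the rank of the map on `k`-th
Čech homology induced by the inclusion of the sublevel sets at `u` and `v`. -/
def persistentBetti (φ : X → ℝ) (u v : ℝ) : ℕ :=
  if h : u ≤ v then
    Module.finrank 𝕂 (LinearMap.range (cechMap 𝕂 k (sublevelIncl φ h)))
  else 0

/-- Multiplicity of a proper point `(u, v)`, `u < v`, of the persistence diagram of `φ`. -/
def properMult (φ : X → ℝ) (u v : ℝ) : ℕ :=
  sInf {m : ℕ | ∃ ε : ℝ, 0 < ε ∧ u + ε < v - ε ∧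
    m = ((persistentBetti 𝕂 k φ (u + ε) (v - ε) : ℤ) - persistentBetti 𝕂 k φ (u - ε) (v - ε)
      - persistentBetti 𝕂 k φ (u + ε) (v + ε) + persistentBetti 𝕂 k φ (u - ε) (v + ε)).toNat}

/-- Multiplicity of a point at infinity `(u, ∞)` of the persistence diagram of `φ`. -/
def essentialMult (φ : X → ℝ) (u : ℝ) : ℕ :=
  sInf {m : ℕ | ∃ ε v : ℝ, 0 < ε ∧ u + ε < v ∧
    m = ((persistentBetti 𝕂 k φ (u + ε) v : ℤ) - persistentBetti 𝕂 k φ (u - ε) v).toNat}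

open Classical in
/-- Multiplicity of the point with birth `u` and death `v ∈ ℝ ∪ {∞}`; it vanishes unless
`u < v`. -/
def mult (φ : X → ℝ) (u : ℝ) : WithTop ℝ → ℕ
  | ⊤ => essentialMult 𝕂 k φ u
  | (v : ℝ) => if u < v then properMult 𝕂 k φ u v else 0

/-- The off-diagonal part of the `k`-th persistence diagram of `φ` as a multiset of pairs
(birth, death): every pair is repeated as often as its multiplicity says. -/
def Dgm (φ : X → ℝ) : Type :=
  Σ p : ℝ × WithTop ℝ, Fin (mult 𝕂 k φ p.1 p.2)

end Persistence

/-! ### Bottleneck distance -/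

/-- Distance of two deaths, with `|∞ - ∞| = 0` and `|∞ - v| = ∞` for real `v`. -/
def deathDist : WithTop ℝ → WithTop ℝ → ℝ≥0∞
  | ⊤, ⊤ => 0
  | (v : ℝ), (w : ℝ) => edist v w
  | _, _ => ⊤

/-- The `ℓ^∞`-distance of two points of the extended half-plane. -/
def pointDist (p q : ℝ × WithTop ℝ) : ℝ≥0∞ :=
  max (edist p.1 q.1) (deathDist p.2 q.2)

/-- The `ℓ^∞`-distance of a point `(u, v)`, `u < v`, from the diagonal. -/
def diagDist : ℝ × WithTop ℝ → ℝ≥0∞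
  | (_, ⊤) => ⊤
  | (u, (v : ℝ)) => ENNReal.ofReal ((v - u) / 2)

/-- The cost of a partial matching between two families of points of the extended half-plane;
unmatched points are sent to the diagonal. -/
def matchingCost {A B : Type*} (pA : A → ℝ × WithTop ℝ) (pB : B → ℝ × WithTop ℝ)
    (σ : A ≃. B) : ℝ≥0∞ :=
  max (⨆ (a : A) (b : B) (_ : σ a = some b), pointDist (pA a) (pB b))
    (max (⨆ (a : A) (_ : σ a = none), diagDist (pA a))
      (⨆ (b : B) (_ : σ.symm b = none), diagDist (pB b)))

section Distances

variable (𝕂 : Type*) [Field 𝕂] (k : ℕ) {X : Type*} [TopologicalSpace X]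

/-- The bottleneck distance of the `k`-th persistence diagrams of two real functions. -/
def bottleneck (φ ψ : X → ℝ) : ℝ≥0∞ :=
  ⨅ σ : Dgm 𝕂 k φ ≃. Dgm 𝕂 k ψ,
    matchingCost (fun a : Dgm 𝕂 k φ => a.1) (fun b : Dgm 𝕂 k ψ => b.1) σ

/-! ### Matching distance, topological difference, topological correlation -/

open Classical in
/-- The normalised filtering function of `Φ = (f, g)` along the line
`t ↦ t • (a, 1 - a) + (b, -b)`, `a ∈ [0, 1]`, `b ∈ ℝ`. For `0 < a < 1` (positive slope) it is
`min a (1 - a) * max ((f - b) / a) ((g + b) / (1 - a))`; the values at `a = 0` and `a = 1`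
(vertical and horizontal direction) are the limits of this expression. -/
def lineFiltration (Φ : X → ℝ × ℝ) (a b : ℝ) (x : X) : ℝ :=
  if a = 0 then max ((Φ x).1 - b) 0
  else if a = 1 then max 0 ((Φ x).2 + b)
  else min a (1 - a) * max (((Φ x).1 - b) / a) (((Φ x).2 + b) / (1 - a))

/-- The matching distance, with horizontal and vertical lines included: the supremum over all
`(a, b) ∈ [0, 1] × ℝ` of the bottleneck distances along the lines. -/
def matchDist (Φ Ψ : X → ℝ × ℝ) : ℝ≥0∞ :=
  ⨆ (a : ℝ) (_ : a ∈ Set.Icc (0 : ℝ) 1) (b : ℝ),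
    bottleneck 𝕂 k (lineFiltration Φ a b) (lineFiltration Ψ a b)

/-- The topological difference of two bifiltrations. -/
def topDiff (Φ Ψ : X → ℝ × ℝ) : ℝ :=
  (matchDist 𝕂 k Φ Ψ).toReal -
    max (bottleneck 𝕂 k (fun x => (Φ x).1) (fun x => (Ψ x).1)).toReal
      (bottleneck 𝕂 k (fun x => (Φ x).2) (fun x => (Ψ x).2)).toReal

/-- The bifiltration `F = (f, f)` attached to `Φ = (f, g)`. -/
def diagFst (Φ : X → ℝ × ℝ) : X → ℝ × ℝ := fun x => ((Φ x).1, (Φ x).1)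

/-- The bifiltration `G = (g, g)` attached to `Φ = (f, g)`. -/
def diagSnd (Φ : X → ℝ × ℝ) : X → ℝ × ℝ := fun x => ((Φ x).2, (Φ x).2)

open Classical in
/-- The topological correlation of the components of `Φ = (f, g)`. -/
def topCorr (Φ : X → ℝ × ℝ) : ℝ :=
  if topDiff 𝕂 k Φ (diagFst Φ) + topDiff 𝕂 k Φ (diagSnd Φ) ≠ 0 then
    2 * max (topDiff 𝕂 k Φ (diagFst Φ)) (topDiff 𝕂 k Φ (diagSnd Φ)) /
      (topDiff 𝕂 k Φ (diagFst Φ) + topDiff 𝕂 k Φ (diagSnd Φ)) - 1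
  else 1

end Distances

/-! ### Standing assumptions -/

/-- `X` is homeomorphic to the underlying space of a finite geometric simplicial complex. -/
def FinitelyTriangulable (X : Type*) [TopologicalSpace X] : Prop :=
  ∃ (n : ℕ) (K : Geometry.SimplicialComplex ℝ (EuclideanSpace ℝ (Fin n))),
    K.faces.Finite ∧ Nonempty (X ≃ₜ K.space)

/-- `Φ` is continuous and all its sublevel sets have finitely generated Čech homology in every
degree. -/
structure Admissible (𝕂 : Type*) [Field 𝕂] {X : Type*} [TopologicalSpace X]
    (Φ : X → ℝ × ℝ) : Prop where
  continuous : Continuous Φ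
  finite : ∀ (k : ℕ) (u : ℝ × ℝ), Module.Finite 𝕂 (CechHomology 𝕂 k {x : X // Φ x ≤ u})

end TopCorr

end

/-!
The algebraic clauses reduce to three facts about the distances: `bottleneck` is a symmetric
function vanishing on the diagonal, `matchDist` is finite, and it bounds the bottleneck distances of
both components from above. Then `topDiff Φ F = matchDist Φ F - bottleneck f g`, and similarly for
`G`, are nonnegative real numbers `s`, `t`, and `topCorr Φ` is `2 * max s t / (s + t) - 1`.

*Lower bound.* For bounded `Φ`, along the vertical line far to the left the filtration is the first
component plus a constant, and along the horizontal line far below it is the second component plus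
a constant. The bottleneck distance is invariant under translations
(`bottleneck_le_add_const`).

*Finiteness.* The stability theorem is not needed. The rank of `H_k(φ ≤ w) → H_k(X)` is a step
function of `w`, and by an inequality between ranks (`inclRank_add_le`) the multiplicities of the
points at infinity are its jumps, so that these points are enumerated, in the order of their births,
by the levels at which the step function crosses `0, …, dim H_k(X) - 1`
(`Tame.exists_enum_essential`). The proper points lie in the square over the range of `φ`. Hence
matching the points at infinity in order, and all proper points with the diagonal, costs at most `D`
as soon as the step functions are `D`-interleaved and the ranges have length at most `2 * D`
(`bottleneck_le`). Since the filtration along a line is the composition of `Φ` with a `1`-Lipschitz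
function of the plane, whose sublevel sets in a bounded region are quadrants (`lineFun_le_add_dist`,
`exists_lineFun_le_iff`), this bound is uniform in the line.

*The example.* On two points take `f = (1, 2)` and `g = (2, 0)`. Exchanging the two points moves
`(f, g)` by at most `1` to `(f, f)`, so that `bottleneck_le` gives `matchDist Φ F ≤ 1`. The
essential class of `g` born at `0` has to be matched with one of `f`, born at `1` or later, so that
`bottleneck f g ≥ 1`. Along the diagonal `Φ` restricts to the constant `2` and `G` to `g`, so that
`matchDist Φ G ≥ 2` for the same reason (`le_bottleneck`).
-/

namespace TopCorr

/-! ### Functoriality of Čech homology and ranks of inclusions -/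

section Ranks

variable (𝕂 : Type*) [Field 𝕂] (k : ℕ)

section Functoriality

variable {X Y Z : Type*} [TopologicalSpace X] [TopologicalSpace Y] [TopologicalSpace Z]

theorem cechMap_comp (g : C(Y, Z)) (f : C(X, Y)) :
    cechMap 𝕂 k (g.comp f) = cechMap 𝕂 k g ∘ₗ cechMap 𝕂 k f := by
  refine LinearMap.ext fun x => Subtype.ext (funext fun V => ?_)
  exact (nerveMap_nerveMap 𝕂 (carries_comap f (V.comap g)) (carries_comap g V) k _).symm

theorem cechMap_id : cechMap 𝕂 k (ContinuousMap.id X) = LinearMap.id := by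
  refine LinearMap.ext fun x => Subtype.ext (funext fun V => ?_)
  exact x.2 (V.comap (.id X)) V (comapIndex _ V) (carries_comap (.id X) V)

theorem cechMap_homeomorph_injective (h : X ≃ₜ Y) :
    Function.Injective (cechMap 𝕂 k (h : C(X, Y))) := by
  have e : cechMap 𝕂 k (h.symm : C(Y, X)) ∘ₗ cechMap 𝕂 k (h : C(X, Y)) = LinearMap.id := by
    rw [← cechMap_comp, ← cechMap_id]
    congr 1
    ext x
    simp
  exact Function.LeftInverse.injective (g := cechMap 𝕂 k (h.symm : C(Y, X)))
    fun x => LinearMap.congr_fun e x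

instance [IsEmpty X] : Subsingleton (CechHomology 𝕂 k X) := by
  have hs (U : FinOpenCover X) : IsEmpty (NerveSimplex U k) :=
    ⟨fun s => s.2.elim fun x _ => isEmptyElim x⟩
  have hc (U : FinOpenCover X) : Subsingleton (NerveChain 𝕂 U k) :=
    have := hs U
    inferInstanceAs (Subsingleton (NerveSimplex U k →₀ 𝕂))
  refine ⟨fun x y => Subtype.ext (funext fun U => ?_)⟩
  obtain ⟨a, ha⟩ := Submodule.Quotient.mk_surjective _ (x.1 U)
  obtain ⟨b, hb⟩ := Submodule.Quotient.mk_surjective _ (y.1 U)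
  rw [← ha, ← hb, Subtype.ext (Subsingleton.elim a.1 b.1)]

end Functoriality

/-- Passing to images under a linear map does not raise the codimension of `I` in `J`. -/
theorem finrank_map_add_finrank_le {V W : Type*} [AddCommGroup V] [Module 𝕂 V] [AddCommGroup W]
    [Module 𝕂 W] (q : V →ₗ[𝕂] W) {I J : Submodule 𝕂 V} (h : I ≤ J) [Module.Finite 𝕂 J] :
    Module.finrank 𝕂 (J.map q) + Module.finrank 𝕂 I ≤
      Module.finrank 𝕂 J + Module.finrank 𝕂 (I.map q) := by
  have : Module.Finite 𝕂 I :=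
    Module.Finite.of_injective (Submodule.inclusion h) (Submodule.inclusion_injective h)
  have hI := (q.domRestrict I).finrank_range_add_finrank_ker
  have hJ := (q.domRestrict J).finrank_range_add_finrank_ker
  rw [LinearMap.range_domRestrict] at hI hJ
  have hker : Module.finrank 𝕂 (LinearMap.ker (q.domRestrict I)) ≤
      Module.finrank 𝕂 (LinearMap.ker (q.domRestrict J)) := by
    let i : LinearMap.ker (q.domRestrict I) →ₗ[𝕂] LinearMap.ker (q.domRestrict J) :=
      (Submodule.inclusion h).restrict fun x hx => by simpa using hx
    refine LinearMap.finrank_le_finrank_of_injective (f := i) fun x y hxy => ?_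
    have : ((i x : J) : V) = (i y : J) := by rw [hxy]
    exact Subtype.ext (Subtype.ext this)
  omega

section InclRank

variable {X Y : Type*} [TopologicalSpace X] [TopologicalSpace Y]

/-- The rank of the map on `k`-th Čech homology induced by an inclusion `A ⊆ B`. -/
noncomputable def inclRank {A B : Set X} (h : A ⊆ B) : ℕ :=
  Module.finrank 𝕂 (LinearMap.range (cechMap 𝕂 k (ContinuousMap.inclusion h)))

theorem inclRank_congr {A A' B B' : Set X} (h : A ⊆ B) (h' : A' ⊆ B') (hA : A = A')
    (hB : B = B') : inclRank 𝕂 k h = inclRank 𝕂 k h' := by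
  subst hA hB
  rfl

theorem inclRank_of_isEmpty {A B : Set X} (h : A ⊆ B) (hA : A = ∅) : inclRank 𝕂 k h = 0 := by
  subst hA
  rw [inclRank, Subsingleton.elim (cechMap 𝕂 k (ContinuousMap.inclusion h)) 0,
    LinearMap.range_zero, finrank_bot]

theorem cechMap_inclusion_trans {A B C : Set X} (h : A ⊆ B) (h' : B ⊆ C) :
    cechMap 𝕂 k (ContinuousMap.inclusion (h.trans h')) =
      cechMap 𝕂 k (ContinuousMap.inclusion h') ∘ₗ cechMap 𝕂 k (ContinuousMap.inclusion h) := by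
  rw [← cechMap_comp]
  rfl

theorem range_cechMap_inclusion_le {A B C : Set X} (h : A ⊆ B) (h' : B ⊆ C) :
    LinearMap.range (cechMap 𝕂 k (ContinuousMap.inclusion (h.trans h'))) ≤
      LinearMap.range (cechMap 𝕂 k (ContinuousMap.inclusion h')) := by
  rw [cechMap_inclusion_trans 𝕂 k h h']
  exact LinearMap.range_comp_le_range _ _

theorem map_range_cechMap_inclusion {A B C : Set X} (h : A ⊆ B) (h' : B ⊆ C) :
    (LinearMap.range (cechMap 𝕂 k (ContinuousMap.inclusion h))).map
        (cechMap 𝕂 k (ContinuousMap.inclusion h')) =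
      LinearMap.range (cechMap 𝕂 k (ContinuousMap.inclusion (h.trans h'))) := by
  rw [cechMap_inclusion_trans 𝕂 k h h', LinearMap.range_comp]

theorem inclRank_mono {A A' B : Set X} (h : A ⊆ A') (h' : A' ⊆ B)
    [Module.Finite 𝕂 (CechHomology 𝕂 k A')] :
    inclRank 𝕂 k (h.trans h') ≤ inclRank 𝕂 k h' :=
  Submodule.finrank_mono (range_cechMap_inclusion_le 𝕂 k h h')

/-- The classes born between `A` and `A'` that are alive in `C` are at most as many as those that
are alive in `B ⊆ C`. -/
theorem inclRank_add_le {A A' B C : Set X} (h : A ⊆ A') (h' : A' ⊆ B) (h'' : B ⊆ C)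
    [Module.Finite 𝕂 (CechHomology 𝕂 k A')] :
    inclRank 𝕂 k (h'.trans h'') + inclRank 𝕂 k (h.trans h') ≤
      inclRank 𝕂 k h' + inclRank 𝕂 k ((h.trans h').trans h'') := by
  have key := finrank_map_add_finrank_le 𝕂 (V := CechHomology 𝕂 k B) (W := CechHomology 𝕂 k C)
    (cechMap 𝕂 k (ContinuousMap.inclusion h'')) (range_cechMap_inclusion_le 𝕂 k h h')
  rw [map_range_cechMap_inclusion, map_range_cechMap_inclusion] at key
  exact key

/-- A homeomorphism of the ambient spaces that carries `A` into `B` does not lower the rank of the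
inclusion into the ambient space. -/
theorem inclRank_univ_le_of_homeomorph (h : X ≃ₜ Y) {A : Set X} {B : Set Y}
    (hAB : ∀ x ∈ A, h x ∈ B) [Module.Finite 𝕂 (CechHomology 𝕂 k B)] :
    inclRank 𝕂 k (Set.subset_univ A) ≤ inclRank 𝕂 k (Set.subset_univ B) := by
  let i : C(A, B) := ⟨fun x => ⟨h x, hAB x x.2⟩, by fun_prop⟩
  let H : (Set.univ : Set X) ≃ₜ (Set.univ : Set Y) :=
    (Homeomorph.Set.univ X).trans (h.trans (Homeomorph.Set.univ Y).symm)
  have e : cechMap 𝕂 k (H : C(_, _)) ∘ₗ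
        cechMap 𝕂 k (ContinuousMap.inclusion (Set.subset_univ A)) =
      cechMap 𝕂 k (ContinuousMap.inclusion (Set.subset_univ B)) ∘ₗ cechMap 𝕂 k i := by
    rw [← cechMap_comp, ← cechMap_comp]
    rfl
  have hinj := cechMap_homeomorph_injective 𝕂 k H
  rw [inclRank, (Submodule.equivMapOfInjective _ hinj _).finrank_eq, ← LinearMap.range_comp, e]
  exact Submodule.finrank_mono (LinearMap.range_comp_le_range _ _)

end InclRank

end Ranks

/-! ### Essential classes -/

section Jumps

/-- The level at which a step function `r` exceeds the value `j`. -/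
noncomputable def crossing (r : ℝ → ℕ) (j : ℕ) : ℝ := sInf {w | j < r w}

variable {r : ℝ → ℕ} {N : ℕ} {m M : ℝ}

theorem bddBelow_crossing (h0 : ∀ w < m, r w = 0) (j : ℕ) : BddBelow {w | j < r w} :=
  ⟨m, fun w hw => not_lt.1 fun hlt => by
    have := h0 w hlt
    simp only [Set.mem_ofPred_eq] at hw
    omega⟩

theorem crossing_le_add {s : ℝ → ℕ} {D : ℝ} (h0 : ∀ w < m, s w = 0) (h1 : ∀ w, M ≤ w → r w = N)
    (hrs : ∀ w, r w ≤ s (w + D)) {j : ℕ} (hj : j < N) : crossing s j ≤ crossing r j + D := by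
  rw [← sub_le_iff_le_add]
  refine le_csInf ⟨M, by simpa [h1 M le_rfl] using hj⟩ fun w hw => ?_
  rw [sub_le_iff_le_add]
  exact csInf_le (bddBelow_crossing h0 j) (lt_of_lt_of_le hw (hrs w))

theorem crossing_eq_iff (hr : Monotone r) (h0 : ∀ w < m, r w = 0) (h1 : ∀ w, M ≤ w → r w = N)
    {u ε : ℝ} (hε : 0 < ε)
    (hc : ∀ δ, 0 < δ → δ ≤ ε → r (u + δ) = r (u + ε) ∧ r (u - δ) = r (u - ε))
    {j : ℕ} (hj : j < N) : crossing r j = u ↔ r (u - ε) ≤ j ∧ j < r (u + ε) := by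
  have hne : {w | j < r w}.Nonempty := ⟨M, by simpa [h1 M le_rfl] using hj⟩
  have hb := bddBelow_crossing h0 j
  constructor
  · rintro rfl
    refine ⟨not_lt.1 fun hlt => ?_, ?_⟩
    · have := csInf_le hb hlt
      change crossing r j ≤ _ at this
      linarith
    · obtain ⟨w, hw, hwu⟩ := exists_lt_of_csInf_lt hne
        (show sInf {w | j < r w} < crossing r j + ε by simpa [crossing] using hε)
      exact lt_of_lt_of_le hw (hr hwu.le)
  · rintro ⟨hl, hu⟩
    apply le_antisymm
    · refine le_of_forall_pos_le_add fun δ hδ => ?_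
      refine (csInf_le hb (a := u + min δ ε) ?_).trans (by gcongr; exact min_le_left _ _)
      rw [Set.mem_ofPred_eq, (hc _ (lt_min hδ hε) (min_le_right _ _)).1]
      exact hu
    · refine le_csInf hne fun w hw => not_lt.1 fun hwu => ?_
      have h2 : r w ≤ r (u - min (u - w) ε) :=
        hr (by linarith [min_le_left (u - w) ε])
      rw [(hc _ (lt_min (sub_pos.2 hwu) hε) (min_le_right _ _)).2] at h2
      exact absurd hw (by simp only [Set.mem_ofPred_eq]; omega)

/-- The jumps of a step function `r` with values between `0` and `N`, counted with multiplicity,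
are the `N` crossing levels of `r`. -/
theorem exists_equiv_jumps (hr : Monotone r) (h0 : ∀ w < m, r w = 0)
    (h1 : ∀ w, M ≤ w → r w = N) {jump : ℝ → ℕ}
    (hjump : ∀ u, ∃ ε > 0, jump u = r (u + ε) - r (u - ε) ∧
      ∀ δ, 0 < δ → δ ≤ ε → r (u + δ) = r (u + ε) ∧ r (u - δ) = r (u - ε)) :
    ∃ e : (Σ u, Fin (jump u)) ≃ Fin N, ∀ a, a.1 = crossing r (e a) := by
  have key (u : ℝ) : Nonempty (Fin (jump u) ≃ {j : Fin N // crossing r j = u}) := by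
    obtain ⟨ε, hε, hj, hc⟩ := hjump u
    have hN : r (u + ε) ≤ N := (hr (le_max_left _ M)).trans (h1 _ (le_max_right _ _)).le
    refine ⟨⟨fun i => ⟨⟨r (u - ε) + i, by omega⟩, ?_⟩,
      fun j => ⟨j.1 - r (u - ε), ?_⟩, fun i => ?_, fun j => ?_⟩⟩
    · have hi := i.2
      rw [crossing_eq_iff hr h0 h1 hε hc (by simp only; omega)]
      simp only
      omega
    · have := (crossing_eq_iff hr h0 h1 hε hc j.1.2).1 j.2
      omega
    · ext
      simp
    · have := (crossing_eq_iff hr h0 h1 hε hc j.1.2).1 j.2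
      ext
      simp only
      omega
  let e := (Equiv.sigmaCongrRight fun u => (key u).some).trans
    (Equiv.sigmaFiberEquiv fun j : Fin N => crossing r j)
  exact ⟨e, fun a => ((key a.1).some a.2).2.symm⟩

end Jumps

/-! ### Tame functions and their persistence diagrams -/

/-- The sublevel set of `φ` at `w`. -/
def sublevel {X : Type*} (φ : X → ℝ) (w : ℝ) : Set X := {x | φ x ≤ w}

theorem sublevel_mono {X : Type*} (φ : X → ℝ) : Monotone (sublevel φ) :=
  fun _ _ h _ hx => le_trans (α := ℝ) hx h

section TameFunctions

variable (𝕂 : Type*) [Field 𝕂] (k : ℕ) {X : Type*} [TopologicalSpace X]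

theorem persistentBetti_eq (φ : X → ℝ) {u v : ℝ} (h : u ≤ v) :
    persistentBetti 𝕂 k φ u v = inclRank 𝕂 k (sublevel_mono φ h) :=
  dif_pos h

/-- The rank of the map on Čech homology induced by the inclusion of the sublevel set at `w` into
the whole space. -/
noncomputable def sublevelRank (φ : X → ℝ) (w : ℝ) : ℕ :=
  inclRank 𝕂 k (Set.subset_univ (sublevel φ w))

/-- The values of `φ` lie in `[m, M]` and the sublevel sets of `φ` have finite-dimensional Čech
homology in degree `k`. -/
structure Tame (φ : X → ℝ) (m M : ℝ) : Prop where
  lower : ∀ x, m ≤ φ x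
  upper : ∀ x, φ x ≤ M
  finite : ∀ w, Module.Finite 𝕂 (CechHomology 𝕂 k (sublevel φ w))

variable {𝕂 k} {φ ψ : X → ℝ} {m M : ℝ}

namespace Tame

theorem sublevel_eq_empty (hφ : Tame 𝕂 k φ m M) {w : ℝ} (hw : w < m) : sublevel φ w = ∅ :=
  Set.eq_empty_of_forall_notMem fun x hx => absurd ((hφ.lower x).trans hx) (not_le.2 hw)

theorem sublevel_eq_univ (hφ : Tame 𝕂 k φ m M) {w : ℝ} (hw : M ≤ w) : sublevel φ w = Set.univ :=
  Set.eq_univ_of_forall fun x => (hφ.upper x).trans hw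

theorem sublevelRank_mono (hφ : Tame 𝕂 k φ m M) : Monotone (sublevelRank 𝕂 k φ) :=
  fun _ v h => have := hφ.finite v
    inclRank_mono 𝕂 k (sublevel_mono φ h) (Set.subset_univ _)

theorem sublevelRank_eq_zero (hφ : Tame 𝕂 k φ m M) {w : ℝ} (hw : w < m) :
    sublevelRank 𝕂 k φ w = 0 :=
  inclRank_of_isEmpty 𝕂 k _ (hφ.sublevel_eq_empty hw)

theorem sublevelRank_eq (hφ : Tame 𝕂 k φ m M) {w : ℝ} (hw : M ≤ w) :
    sublevelRank 𝕂 k φ w = inclRank 𝕂 k (Set.subset_univ (Set.univ : Set X)) :=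
  inclRank_congr 𝕂 k _ _ (hφ.sublevel_eq_univ hw) rfl

theorem persistentBetti_eq_zero (hφ : Tame 𝕂 k φ m M) {u v : ℝ} (hu : u < m) :
    persistentBetti 𝕂 k φ u v = 0 := by
  by_cases h : u ≤ v
  · rw [persistentBetti_eq 𝕂 k φ h]
    exact inclRank_of_isEmpty 𝕂 k _ (hφ.sublevel_eq_empty hu)
  · exact dif_neg h

theorem persistentBetti_eq_sublevelRank (hφ : Tame 𝕂 k φ m M) {u v : ℝ} (h : u ≤ v)
    (hv : M ≤ v) : persistentBetti 𝕂 k φ u v = sublevelRank 𝕂 k φ u := by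
  rw [persistentBetti_eq 𝕂 k φ h]
  exact inclRank_congr 𝕂 k _ _ rfl (hφ.sublevel_eq_univ hv)

theorem sublevelRank_add_persistentBetti_le (hφ : Tame 𝕂 k φ m M) {u u' v : ℝ} (h : u ≤ u')
    (h' : u' ≤ v) : sublevelRank 𝕂 k φ u' + persistentBetti 𝕂 k φ u v ≤
      persistentBetti 𝕂 k φ u' v + sublevelRank 𝕂 k φ u := by
  rw [persistentBetti_eq 𝕂 k φ h', persistentBetti_eq 𝕂 k φ (h.trans h')]
  have := hφ.finite u'
  exact inclRank_add_le 𝕂 k (sublevel_mono φ h) (sublevel_mono φ h') (Set.subset_univ _)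

/-- The multiplicity of a point at infinity is the jump of the rank function of `φ`. -/
theorem exists_essentialMult_eq (hφ : Tame 𝕂 k φ m M) (u : ℝ) :
    ∃ ε > 0, essentialMult 𝕂 k φ u = sublevelRank 𝕂 k φ (u + ε) - sublevelRank 𝕂 k φ (u - ε) ∧
      ∀ δ, 0 < δ → δ ≤ ε → sublevelRank 𝕂 k φ (u + δ) = sublevelRank 𝕂 k φ (u + ε) ∧
        sublevelRank 𝕂 k φ (u - δ) = sublevelRank 𝕂 k φ (u - ε) := by
  have hle (δ : ℝ) (hδ : 0 < δ) : essentialMult 𝕂 k φ u ≤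
      sublevelRank 𝕂 k φ (u + δ) - sublevelRank 𝕂 k φ (u - δ) := by
    -- Beyond the maximum of `φ` the persistent Betti numbers are the values of the rank function.
    refine Nat.sInf_le ⟨δ, max M (u + δ) + 1, hδ, by linarith [le_max_right M (u + δ)], ?_⟩
    rw [hφ.persistentBetti_eq_sublevelRank (by linarith [le_max_right M (u + δ)])
      (by linarith [le_max_left M (u + δ)]),
      hφ.persistentBetti_eq_sublevelRank (by linarith [le_max_right M (u + δ)])
      (by linarith [le_max_left M (u + δ)])]
    omega
  obtain ⟨ε, v, hε, hv, he⟩ := Nat.sInf_mem (s := {n : ℕ | ∃ ε v : ℝ, 0 < ε ∧ u + ε < v ∧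
    n = ((persistentBetti 𝕂 k φ (u + ε) v : ℤ) - persistentBetti 𝕂 k φ (u - ε) v).toNat})
    ⟨_, 1, u + 2, one_pos, by linarith, rfl⟩
  change essentialMult 𝕂 k φ u = _ at he
  -- The rank inequality makes a large `v` optimal, so that the infimum is the jump of the rank
  -- function over `(u - ε, u + ε]`; by minimality this jump stays the same for smaller `ε`.
  have hge := hφ.sublevelRank_add_persistentBetti_le (show u - ε ≤ u + ε by linarith) hv.le
  have hmono := hφ.sublevelRank_mono
  have h1 : sublevelRank 𝕂 k φ (u - ε) ≤ sublevelRank 𝕂 k φ (u + ε) := hmono (by linarith)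
  have h2 := hle ε hε
  refine ⟨ε, hε, by omega, fun δ hδ hδε => ?_⟩
  have h3 := hle δ hδ
  have h4 : sublevelRank 𝕂 k φ (u + δ) ≤ sublevelRank 𝕂 k φ (u + ε) := hmono (by linarith)
  have h5 : sublevelRank 𝕂 k φ (u - ε) ≤ sublevelRank 𝕂 k φ (u - δ) := hmono (by linarith)
  have h6 : sublevelRank 𝕂 k φ (u - δ) ≤ sublevelRank 𝕂 k φ (u + δ) := hmono (by linarith)
  omega

/-- The points at infinity of the persistence diagram are enumerated by the crossing levels of the
rank function. -/
theorem exists_enum_essential (hφ : Tame 𝕂 k φ m M) :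
    ∃ ι : Fin (inclRank 𝕂 k (Set.subset_univ (Set.univ : Set X))) → Dgm 𝕂 k φ,
      Function.Injective ι ∧ (∀ a : Dgm 𝕂 k φ, a.1.2 = ⊤ → ∃ j, ι j = a) ∧
        ∀ j, (ι j).1 = (crossing (sublevelRank 𝕂 k φ) j, ⊤) := by
  obtain ⟨e, he⟩ := exists_equiv_jumps hφ.sublevelRank_mono (fun w => hφ.sublevelRank_eq_zero)
    (fun w => hφ.sublevelRank_eq) hφ.exists_essentialMult_eq
  let i : (Σ u, Fin (essentialMult 𝕂 k φ u)) → Dgm 𝕂 k φ := fun a => ⟨(a.1, ⊤), a.2⟩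
  have hi : Function.Injective i := by
    rintro ⟨u, a⟩ ⟨v, b⟩ h
    obtain ⟨h1, h2⟩ := Sigma.mk.inj_iff.1 h
    obtain rfl : u = v := congrArg Prod.fst h1
    exact congrArg (Sigma.mk u) (eq_of_heq h2)
  refine ⟨fun j => i (e.symm j), hi.comp e.symm.injective, ?_, fun j => ?_⟩
  · rintro ⟨⟨u, v⟩, a⟩ rfl
    exact ⟨e ⟨u, a⟩, congrArg i (e.symm_apply_apply ⟨u, a⟩)⟩
  · have := he (e.symm j)
    rw [e.apply_symm_apply] at this
    rw [← this]

/-- Births of the points at infinity are bounded below by the values of the function. -/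
theorem le_birth_of_essential (hφ : Tame 𝕂 k φ m M) (a : Dgm 𝕂 k φ) (ha : a.1.2 = ⊤) :
    m ≤ a.1.1 := by
  obtain ⟨⟨u, v⟩, i⟩ := a
  obtain rfl : v = ⊤ := ha
  by_contra! hu
  -- Below `m` the rank function vanishes and has no jump.
  have hlt : 0 < essentialMult 𝕂 k φ u := i.pos
  obtain ⟨ε, hε, he, hc⟩ := hφ.exists_essentialMult_eq u
  have hδ : 0 < min ε ((m - u) / 2) := lt_min hε (by simp only at hu; linarith)
  have h := (hc _ hδ (min_le_left _ _)).1
  have h0 : sublevelRank 𝕂 k φ (u + min ε ((m - u) / 2)) = 0 :=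
    hφ.sublevelRank_eq_zero (by
      simp only at hu
      linarith [min_le_right ε ((m - u) / 2)])
  omega

/-- The proper points of the persistence diagram lie in the square over the range of the
function. -/
theorem bounds_of_properMult_ne_zero (hφ : Tame 𝕂 k φ m M) {u v : ℝ} (huv : u < v)
    (h : properMult 𝕂 k φ u v ≠ 0) : m ≤ u ∧ v ≤ M := by
  constructor
  -- For small `ε` all four persistent Betti numbers vanish.
  · by_contra! hu
    refine h (Nat.sInf_eq_zero.2 (.inl ⟨min (m - u) (v - u) / 3, ?_, ?_, ?_⟩))
    · have := lt_min (sub_pos.2 hu) (sub_pos.2 huv)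
      positivity
    · linarith [min_le_right (m - u) (v - u)]
    · have h1 := min_le_left (m - u) (v - u)
      have h2 := lt_min (sub_pos.2 hu) (sub_pos.2 huv)
      simp only [hφ.persistentBetti_eq_zero (show u + min (m - u) (v - u) / 3 < m by linarith),
        hφ.persistentBetti_eq_zero (show u - min (m - u) (v - u) / 3 < m by linarith)]
      simp
  -- For small `ε` the persistent Betti numbers do not depend on the second argument and cancel.
  · by_contra! hv
    refine h (Nat.sInf_eq_zero.2 (.inl ⟨min (v - M) (v - u) / 3, ?_, ?_, ?_⟩))
    · have := lt_min (sub_pos.2 hv) (sub_pos.2 huv)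
      positivity
    · linarith [min_le_right (v - M) (v - u)]
    · have h1 := min_le_left (v - M) (v - u)
      have h2 := lt_min (sub_pos.2 hv) (sub_pos.2 huv)
      have h3 := min_le_right (v - M) (v - u)
      rw [hφ.persistentBetti_eq_sublevelRank (by linarith) (by linarith),
        hφ.persistentBetti_eq_sublevelRank (by linarith) (by linarith),
        hφ.persistentBetti_eq_sublevelRank (by linarith) (by linarith),
        hφ.persistentBetti_eq_sublevelRank (by linarith) (by linarith)]
      simp

theorem diagDist_le (hφ : Tame 𝕂 k φ m M) {D : ℝ} (hD : M - m ≤ 2 * D) (a : Dgm 𝕂 k φ)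
    (ha : a.1.2 ≠ ⊤) : diagDist a.1 ≤ ENNReal.ofReal D := by
  obtain ⟨⟨u, v⟩, i⟩ := a
  induction v with
  | top => exact absurd rfl ha
  | coe v =>
    have hi : 0 < if u < v then properMult 𝕂 k φ u v else 0 := i.pos
    split_ifs at hi with huv
    · have := hφ.bounds_of_properMult_ne_zero huv hi.ne'
      exact ENNReal.ofReal_le_ofReal (by linarith)
    · exact absurd hi (lt_irrefl _)

end Tame

/-! ### Bounds for the bottleneck distance -/

/-- The partial equivalence between the ranges of two injections of the same type. -/
theorem exists_pequiv_of_injective {J A B : Type*} {i : J → A} {i' : J → B}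
    (hi : Function.Injective i) (hi' : Function.Injective i') :
    ∃ σ : A ≃. B, ∀ a b, σ a = some b ↔ ∃ j, i j = a ∧ i' j = b := by
  have h (a : A) (j : J) : Function.partialInv i a = some j ↔ i j = a := hi.isPartialInv j a
  have h' (b : B) (j : J) : Function.partialInv i' b = some j ↔ i' j = b := hi'.isPartialInv j b
  refine ⟨⟨fun a => (Function.partialInv i a).map i', fun b => (Function.partialInv i' b).map i,
    fun a b => ?_⟩, fun a b => ?_⟩
  · simp only [Option.map_eq_some_iff, h, h', and_comm]
  · change Option.map i' (Function.partialInv i a) = some b ↔ _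
    simp only [Option.map_eq_some_iff, h]

/-- If the ranks of the sublevel sets of `φ` and `ψ` are `D`-interleaved and the values of either
function lie in an interval of length `2 * D`, then matching the points at infinity in the order of
their births, and the proper points with the diagonal, costs at most `D`. -/
theorem bottleneck_le {m' M' D : ℝ} (hφ : Tame 𝕂 k φ m M) (hψ : Tame 𝕂 k ψ m' M')
    (hD : M - m ≤ 2 * D) (hD' : M' - m' ≤ 2 * D)
    (h : ∀ w, sublevelRank 𝕂 k φ w ≤ sublevelRank 𝕂 k ψ (w + D))
    (h' : ∀ w, sublevelRank 𝕂 k ψ w ≤ sublevelRank 𝕂 k φ (w + D)) :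
    bottleneck 𝕂 k φ ψ ≤ ENNReal.ofReal D := by
  obtain ⟨ι, hι, hs, hc⟩ := hφ.exists_enum_essential
  obtain ⟨ι', hι', hs', hc'⟩ := hψ.exists_enum_essential
  obtain ⟨σ, hσ⟩ := exists_pequiv_of_injective hι hι'
  refine iInf_le_of_le σ (max_le ?_ (max_le ?_ ?_))
  · refine iSup_le fun a => iSup_le fun b => iSup_le fun hab => ?_
    obtain ⟨j, rfl, rfl⟩ := (hσ a b).1 hab
    simp only [hc, hc']
    refine max_le ?_ (zero_le)
    have h1 := crossing_le_add (fun w => hψ.sublevelRank_eq_zero) (fun w => hφ.sublevelRank_eq)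
      h j.2
    have h2 := crossing_le_add (fun w => hφ.sublevelRank_eq_zero) (fun w => hψ.sublevelRank_eq)
      h' j.2
    rw [edist_dist, Real.dist_eq]
    exact ENNReal.ofReal_le_ofReal (abs_sub_le_iff.2 ⟨by linarith, by linarith⟩)
  · refine iSup_le fun a => iSup_le fun ha => hφ.diagDist_le hD a fun htop => ?_
    obtain ⟨j, rfl⟩ := hs a htop
    rw [(hσ _ _).2 ⟨j, rfl, rfl⟩] at ha
    cases ha
  · refine iSup_le fun b => iSup_le fun hb => hψ.diagDist_le hD' b fun htop => ?_
    obtain ⟨j, rfl⟩ := hs' b htop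
    rw [σ.eq_some_iff.2 ((hσ _ _).2 ⟨j, rfl, rfl⟩)] at hb
    cases hb

/-- The bottleneck distance of two functions with values in `[m, M]` is at most `M - m`. -/
theorem bottleneck_le_sub (hφ : Tame 𝕂 k φ m M) (hψ : Tame 𝕂 k ψ m M) (hmM : m ≤ M) :
    bottleneck 𝕂 k φ ψ ≤ ENNReal.ofReal (M - m) := by
  have key {α β : X → ℝ} (hα : Tame 𝕂 k α m M) (hβ : Tame 𝕂 k β m M) (w : ℝ) :
      sublevelRank 𝕂 k α w ≤ sublevelRank 𝕂 k β (w + (M - m)) := by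
    rcases lt_or_ge w m with hw | hw
    · rw [hα.sublevelRank_eq_zero hw]
      exact Nat.zero_le _
    · rw [hβ.sublevelRank_eq (by linarith), ← hα.sublevelRank_eq (le_max_right w M)]
      exact hα.sublevelRank_mono (le_max_left w M)
  exact bottleneck_le hφ hψ (by linarith) (by linarith) (key hφ hψ) (key hψ hφ)

/-- Comparison of the ranks of sublevel sets through a self-homeomorphism of `X`. -/
theorem Tame.sublevelRank_le_of_homeomorph (hψ : Tame 𝕂 k ψ m M) (h : X ≃ₜ X) {D : ℝ}
    (hD : ∀ x, ψ (h x) ≤ φ x + D) (w : ℝ) :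
    sublevelRank 𝕂 k φ w ≤ sublevelRank 𝕂 k ψ (w + D) := by
  have := hψ.finite (w + D)
  refine inclRank_univ_le_of_homeomorph 𝕂 k h fun x hx => ?_
  have hx' : φ x ≤ w := hx
  exact (hD x).trans (by linarith)

/-- A point at infinity that is born at `c` is at distance at least `D` from all points at infinity
of a diagram whose births are at least `c + D`. -/
theorem le_bottleneck {c D : ℝ} (hφ : Tame 𝕂 k φ (c + D) M)
    (hψ : essentialMult 𝕂 k ψ c ≠ 0) : ENNReal.ofReal D ≤ bottleneck 𝕂 k φ ψ := by
  refine le_iInf fun σ => ?_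
  let b : Dgm 𝕂 k ψ := ⟨(c, ⊤), ⟨0, Nat.pos_of_ne_zero hψ⟩⟩
  rcases hb : σ.symm b with _ | a
  · have : (⊤ : ℝ≥0∞) ≤ ⨆ (b : Dgm 𝕂 k ψ) (_ : σ.symm b = none), diagDist b.1 :=
      le_iSup₂_of_le b hb le_rfl
    exact le_top.trans (this.trans ((le_max_right _ _).trans (le_max_right _ _)))
  · have hab : σ a = some b := σ.eq_some_iff.1 hb
    refine le_trans ?_ (le_max_left _ _)
    refine le_trans ?_ (le_iSup_of_le a (le_iSup₂_of_le b hab le_rfl))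
    by_cases ha : a.1.2 = ⊤
    · refine le_trans ?_ (le_max_left _ _)
      have h1 := hφ.le_birth_of_essential a ha
      rw [edist_dist, Real.dist_eq]
      exact ENNReal.ofReal_le_ofReal (le_trans (by simp only [b]; linarith) (le_abs_self _))
    · refine le_trans ?_ (le_max_right _ _)
      obtain ⟨⟨u, v⟩, i⟩ := a
      induction v with
      | top => exact absurd rfl ha
      | coe v => exact le_top

theorem bottleneck_self : bottleneck 𝕂 k φ φ = 0 := by
  refine le_antisymm (iInf_le_of_le (PEquiv.refl _) ?_) (zero_le)
  refine max_le ?_ (max_le ?_ ?_)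
  · refine iSup_le fun a => iSup_le fun b => iSup_le fun hab => ?_
    obtain rfl : a = b := Option.some.inj hab
    obtain ⟨⟨u, v⟩, i⟩ := a
    induction v with
    | top => simp [pointDist, deathDist]
    | coe v => simp [pointDist, deathDist]
  · simp
  · simp

theorem pointDist_comm (p q : ℝ × WithTop ℝ) : pointDist p q = pointDist q p := by
  obtain ⟨u, v⟩ := p
  obtain ⟨u', v'⟩ := q
  have : deathDist v v' = deathDist v' v := by
    induction v <;> induction v' <;> simp [deathDist, edist_comm]
  simp [pointDist, edist_comm, this]

theorem bottleneck_comm : bottleneck 𝕂 k φ ψ = bottleneck 𝕂 k ψ φ := by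
  have key (α β : X → ℝ) : bottleneck 𝕂 k α β ≤ bottleneck 𝕂 k β α := by
    refine le_iInf fun σ => iInf_le_of_le σ.symm ?_
    refine max_le ?_ (max_le ?_ ?_)
    · refine le_trans ?_ (le_max_left _ _)
      refine iSup_le fun a => iSup_le fun b => iSup_le fun hab => ?_
      rw [pointDist_comm]
      exact le_iSup_of_le b (le_iSup₂_of_le a (σ.eq_some_iff.1 hab) le_rfl)
    · exact (le_max_right _ _).trans (le_max_right _ _)
    · exact (le_max_left _ _).trans (le_max_right _ _)
  exact le_antisymm (key φ ψ) (key ψ φ)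

end TameFunctions

/-! ### Translation invariance of the bottleneck distance -/

section Translation

variable {𝕂 : Type*} [Field 𝕂] {k : ℕ} {X : Type*} [TopologicalSpace X]

theorem bottleneck_le_of_equiv {φ ψ φ' ψ' : X → ℝ} (τ : ℝ × WithTop ℝ → ℝ × WithTop ℝ)
    (hp : ∀ p q, pointDist (τ p) (τ q) = pointDist p q) (hd : ∀ p, diagDist (τ p) = diagDist p)
    (e : Dgm 𝕂 k φ ≃ Dgm 𝕂 k φ') (he : ∀ a, (e a).1 = τ a.1)
    (e' : Dgm 𝕂 k ψ ≃ Dgm 𝕂 k ψ') (he' : ∀ b, (e' b).1 = τ b.1) :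
    bottleneck 𝕂 k φ ψ ≤ bottleneck 𝕂 k φ' ψ' := by
  refine le_iInf fun σ => ?_
  let σ' : Dgm 𝕂 k φ ≃. Dgm 𝕂 k ψ :=
    ⟨fun a => (σ (e a)).map e'.symm, fun b => (σ.symm (e' b)).map e.symm, fun a b => by
      simp only [Option.map_eq_some_iff, Equiv.symm_apply_eq, exists_eq_right, σ.eq_some_iff]⟩
  have hσ (a : Dgm 𝕂 k φ) : σ' a = (σ (e a)).map e'.symm := rfl
  have hσs (b : Dgm 𝕂 k ψ) : σ'.symm b = (σ.symm (e' b)).map e.symm := rfl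
  refine iInf_le_of_le σ' (max_le_max ?_ (max_le_max ?_ ?_))
  · refine iSup_le fun a => iSup_le fun b => iSup_le fun hab => ?_
    simp only [hσ, Option.map_eq_some_iff, Equiv.symm_apply_eq, exists_eq_right] at hab
    rw [← hp, ← he, ← he']
    exact le_iSup_of_le (e a) (le_iSup₂_of_le (e' b) hab le_rfl)
  · refine iSup_le fun a => iSup_le fun ha => ?_
    rw [hσ, Option.map_eq_none_iff] at ha
    rw [← hd, ← he]
    exact le_iSup₂_of_le (e a) ha le_rfl
  · refine iSup_le fun b => iSup_le fun hb => ?_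
    rw [hσs, Option.map_eq_none_iff] at hb
    rw [← hd, ← he']
    exact le_iSup₂_of_le (e' b) hb le_rfl

variable (𝕂 k) (φ ψ : X → ℝ) (c : ℝ)

theorem persistentBetti_add_const (u v : ℝ) :
    persistentBetti 𝕂 k (fun x => φ x + c) u v = persistentBetti 𝕂 k φ (u - c) (v - c) := by
  by_cases h : u ≤ v
  · have h' : u - c ≤ v - c := by linarith
    have hs (w : ℝ) : sublevel (fun x => φ x + c) w = sublevel φ (w - c) :=
      Set.ext fun x => (le_sub_iff_add_le (a := φ x)).symm
    rw [persistentBetti_eq 𝕂 k _ h, persistentBetti_eq 𝕂 k _ h']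
    exact inclRank_congr 𝕂 k _ _ (hs u) (hs v)
  · rw [persistentBetti, dif_neg h, persistentBetti, dif_neg (by simpa using h)]

theorem properMult_add_const (u v : ℝ) :
    properMult 𝕂 k (fun x => φ x + c) (u + c) (v + c) = properMult 𝕂 k φ u v := by
  unfold properMult
  congr 1
  ext m
  simp only [Set.mem_ofPred_eq, persistentBetti_add_const, add_right_comm _ c,
    add_sub_right_comm _ c, sub_add_cancel, add_lt_add_iff_right]

theorem essentialMult_add_const (u : ℝ) :
    essentialMult 𝕂 k (fun x => φ x + c) (u + c) = essentialMult 𝕂 k φ u := by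
  unfold essentialMult
  congr 1
  ext m
  simp only [Set.mem_ofPred_eq, persistentBetti_add_const, add_right_comm _ c,
    add_sub_right_comm _ c, sub_add_cancel]
  refine exists_congr fun ε => (Equiv.subRight c).exists_congr fun v => ?_
  simp only [Equiv.subRight_apply, lt_sub_iff_add_lt]

/-- The shift of the extended half-plane along the diagonal. -/
def shift : ℝ × WithTop ℝ ≃ ℝ × WithTop ℝ :=
  (Equiv.addRight c).prodCongr ((Equiv.addRight c).withTopCongr)

theorem mult_shift (p : ℝ × WithTop ℝ) :
    mult 𝕂 k (fun x => φ x + c) (shift c p).1 (shift c p).2 = mult 𝕂 k φ p.1 p.2 := by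
  obtain ⟨u, v⟩ := p
  induction v with
  | top => exact essentialMult_add_const 𝕂 k φ c u
  | coe v =>
    change (if u + c < v + c then properMult 𝕂 k (fun x => φ x + c) (u + c) (v + c) else 0) =
      if u < v then properMult 𝕂 k φ u v else 0
    simp only [properMult_add_const, add_lt_add_iff_right]

theorem bottleneck_le_add_const :
    bottleneck 𝕂 k φ ψ ≤ bottleneck 𝕂 k (fun x => φ x + c) (fun x => ψ x + c) := by
  refine bottleneck_le_of_equiv (shift c) ?_ ?_
    ((shift c).sigmaCongr fun p => finCongr (mult_shift 𝕂 k φ c p).symm) (fun _ => rfl)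
    ((shift c).sigmaCongr fun p => finCongr (mult_shift 𝕂 k ψ c p).symm) (fun _ => rfl)
  · rintro ⟨u, v⟩ ⟨u', v'⟩
    have h : edist (u + c) (u' + c) = edist u u' := edist_add_right _ _ _
    induction v with
    | top => induction v' with
      | top => exact congrArg (max · 0) h
      | coe v' => exact congrArg (max · ⊤) h
    | coe v => induction v' with
      | top => exact congrArg (max · ⊤) h
      | coe v' => exact congrArg₂ max h (edist_add_right v v' c)
  · rintro ⟨u, v⟩
    induction v with
    | top => rfl
    | coe v =>
      change ENNReal.ofReal ((v + c - (u + c)) / 2) = ENNReal.ofReal ((v - u) / 2)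
      rw [add_sub_add_right_eq_sub]

end Translation

/-! ### Filtrations along lines -/

section Lines

open Classical in
/-- The function of the plane whose composition with `Φ` is `lineFiltration Φ a b`. For `0 < a < 1`
its sublevel sets are the quadrants with corner on the line with parameters `(a, b)`. -/
noncomputable def lineFun (a b : ℝ) (p : ℝ × ℝ) : ℝ :=
  if a = 0 then max (p.1 - b) 0
  else if a = 1 then max 0 (p.2 + b)
  else min a (1 - a) * max ((p.1 - b) / a) ((p.2 + b) / (1 - a))

theorem lineFun_le_add_dist {a : ℝ} (ha : a ∈ Set.Icc (0 : ℝ) 1) (b : ℝ) (p q : ℝ × ℝ) :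
    lineFun a b p ≤ lineFun a b q + dist p q := by
  have h1 : p.1 ≤ q.1 + dist p q := by
    have : |p.1 - q.1| ≤ dist p q := le_max_left _ _
    linarith [le_abs_self (p.1 - q.1)]
  have h2 : p.2 ≤ q.2 + dist p q := by
    have : |p.2 - q.2| ≤ dist p q := le_max_right _ _
    linarith [le_abs_self (p.2 - q.2)]
  have h0 : 0 ≤ dist p q := dist_nonneg
  unfold lineFun
  split_ifs with ha0 ha1
  · rw [max_add]
    exact max_le_max (by linarith) (by linarith)
  · rw [max_add]
    exact max_le_max (by linarith) (by linarith)
  · have hapos : 0 < a := lt_of_le_of_ne ha.1 (Ne.symm ha0)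
    have hapos' : 0 < 1 - a := sub_pos.2 (lt_of_le_of_ne ha.2 ha1)
    have hc : 0 ≤ min a (1 - a) := (lt_min hapos hapos').le
    -- Both coefficients `min a (1 - a) / a` and `min a (1 - a) / (1 - a)` are at most `1`.
    have step {s t d : ℝ} (hd : 0 < d) (hcd : min a (1 - a) ≤ d) (hst : s ≤ t + dist p q) :
        min a (1 - a) * (s / d) ≤ min a (1 - a) * (t / d) + dist p q := by
      have e : min a (1 - a) * (s / d) ≤ min a (1 - a) * ((t + dist p q) / d) := by gcongr
      have e' : min a (1 - a) / d * dist p q ≤ 1 * dist p q :=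
        mul_le_mul_of_nonneg_right ((div_le_one hd).2 hcd) h0
      calc _ ≤ _ := e
        _ = min a (1 - a) * (t / d) + min a (1 - a) / d * dist p q := by ring
        _ ≤ _ := by linarith
    rw [mul_max_of_nonneg _ _ hc, mul_max_of_nonneg _ _ hc, max_add]
    exact max_le_max (step hapos (min_le_left _ _) (by linarith))
      (step hapos' (min_le_right _ _) (by linarith))

/-- On a bounded set, the sublevel sets of `lineFun a b` are quadrants. -/
theorem exists_lineFun_le_iff {a : ℝ} (ha : a ∈ Set.Icc (0 : ℝ) 1) (b w : ℝ) (p : ℝ × ℝ) (R : ℝ) :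
    ∃ u : ℝ × ℝ, ∀ q : ℝ × ℝ, dist q p ≤ R → (lineFun a b q ≤ w ↔ q ≤ u) := by
  have hb (q : ℝ × ℝ) (hq : dist q p ≤ R) :
      (p.1 - R ≤ q.1 ∧ q.1 ≤ p.1 + R) ∧ (p.2 - R ≤ q.2 ∧ q.2 ≤ p.2 + R) := by
    have h1 := abs_sub_le_iff.1 ((le_max_left _ _ : dist q.1 p.1 ≤ dist q p).trans hq)
    have h2 := abs_sub_le_iff.1 ((le_max_right _ _ : dist q.2 p.2 ≤ dist q p).trans hq)
    exact ⟨⟨by linarith, by linarith⟩, ⟨by linarith, by linarith⟩⟩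
  by_cases ha0 : a = 0
  · -- For `w < 0` the sublevel set is empty, like a quadrant that misses the ball.
    rcases lt_or_ge w 0 with hw | hw
    · refine ⟨(p.1 - R - 1, 0), fun q hq => ?_⟩
      rw [lineFun, if_pos ha0, max_le_iff, Prod.le_def]
      exact ⟨fun h => absurd h.2 (not_le.2 hw), fun h => absurd h.1 (by
        have := hb q hq
        simp only
        linarith)⟩
    · refine ⟨(w + b, p.2 + R), fun q hq => ?_⟩
      rw [lineFun, if_pos ha0, max_le_iff, Prod.le_def, sub_le_iff_le_add]
      exact ⟨fun h => ⟨h.1, (hb q hq).2.2⟩, fun h => ⟨h.1, hw⟩⟩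
  by_cases ha1 : a = 1
  · rcases lt_or_ge w 0 with hw | hw
    · refine ⟨(0, p.2 - R - 1), fun q hq => ?_⟩
      rw [lineFun, if_neg ha0, if_pos ha1, max_le_iff, Prod.le_def]
      exact ⟨fun h => absurd h.1 (not_le.2 hw), fun h => absurd h.2 (by
        have := hb q hq
        simp only
        linarith)⟩
    · refine ⟨(p.1 + R, w - b), fun q hq => ?_⟩
      rw [lineFun, if_neg ha0, if_pos ha1, max_le_iff, Prod.le_def, ← le_sub_iff_add_le]
      exact ⟨fun h => ⟨(hb q hq).1.2, h.2⟩, fun h => ⟨hw, h.2⟩⟩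
  have hapos : 0 < a := lt_of_le_of_ne ha.1 (Ne.symm ha0)
  have hapos' : 0 < 1 - a := sub_pos.2 (lt_of_le_of_ne ha.2 ha1)
  refine ⟨(w / min a (1 - a) * a + b, w / min a (1 - a) * (1 - a) - b), fun q _ => ?_⟩
  rw [lineFun, if_neg ha0, if_neg ha1, ← le_div_iff₀' (lt_min hapos hapos'), max_le_iff,
    div_le_iff₀ hapos, div_le_iff₀ hapos', sub_le_iff_le_add, ← le_sub_iff_add_le, Prod.le_def]

variable {𝕂 : Type*} [Field 𝕂] {k : ℕ} {X : Type*} [TopologicalSpace X]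
  {Φ Ψ : X → ℝ × ℝ} {p : ℝ × ℝ} {R : ℝ}

theorem Admissible.finite_sublevel (hΦ : Admissible 𝕂 Φ) {φ : X → ℝ} {w : ℝ} (u : ℝ × ℝ)
    (hu : ∀ x, φ x ≤ w ↔ Φ x ≤ u) : Module.Finite 𝕂 (CechHomology 𝕂 k (sublevel φ w)) := by
  have : sublevel φ w = {x | Φ x ≤ u} := Set.ext hu
  rw [this]
  exact hΦ.finite k u

theorem Admissible.tame_lineFiltration (hΦ : Admissible 𝕂 Φ) (hR : ∀ x, dist (Φ x) p ≤ R) {a : ℝ}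
    (ha : a ∈ Set.Icc (0 : ℝ) 1) (b : ℝ) :
    Tame 𝕂 k (lineFiltration Φ a b) (lineFun a b p - R) (lineFun a b p + R) where
  lower x := by
    have h := lineFun_le_add_dist ha b p (Φ x)
    rw [dist_comm] at h
    have h' : lineFun a b p - R ≤ lineFun a b (Φ x) := by linarith [hR x]
    exact h'
  upper x := (lineFun_le_add_dist ha b (Φ x) p).trans (by linarith [hR x])
  finite w := by
    obtain ⟨u, hu⟩ := exists_lineFun_le_iff ha b w p R
    exact hΦ.finite_sublevel u fun x => hu _ (hR x)

theorem Admissible.tame_fst (hΦ : Admissible 𝕂 Φ) (hR : ∀ x, dist (Φ x) p ≤ R) :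
    Tame 𝕂 k (fun x => (Φ x).1) (p.1 - R) (p.1 + R) := by
  have h (x : X) := abs_sub_le_iff.1 ((le_max_left _ _ : dist (Φ x).1 p.1 ≤ _).trans (hR x))
  have h' (x : X) := abs_sub_le_iff.1 ((le_max_right _ _ : dist (Φ x).2 p.2 ≤ _).trans (hR x))
  exact ⟨fun x => by linarith [(h x).2], fun x => by linarith [(h x).1],
    fun w => hΦ.finite_sublevel (w, p.2 + R) fun x =>
      ⟨fun hx => ⟨hx, show (Φ x).2 ≤ p.2 + R by linarith [(h' x).1]⟩, fun hx => hx.1⟩⟩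

theorem Admissible.tame_snd (hΦ : Admissible 𝕂 Φ) (hR : ∀ x, dist (Φ x) p ≤ R) :
    Tame 𝕂 k (fun x => (Φ x).2) (p.2 - R) (p.2 + R) := by
  have h (x : X) := abs_sub_le_iff.1 ((le_max_left _ _ : dist (Φ x).1 p.1 ≤ _).trans (hR x))
  have h' (x : X) := abs_sub_le_iff.1 ((le_max_right _ _ : dist (Φ x).2 p.2 ≤ _).trans (hR x))
  exact ⟨fun x => by linarith [(h' x).2], fun x => by linarith [(h' x).1],
    fun w => hΦ.finite_sublevel (p.1 + R, w) fun x =>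
      ⟨fun hx => ⟨show (Φ x).1 ≤ p.1 + R by linarith [(h x).1], hx⟩, fun hx => hx.2⟩⟩

theorem Admissible.diagFst [CompactSpace X] (hΦ : Admissible 𝕂 Φ) :
    Admissible 𝕂 (diagFst Φ) where
  continuous := hΦ.continuous.fst.prodMk hΦ.continuous.fst
  finite k u := by
    obtain ⟨R, hR⟩ := (isCompact_range hΦ.continuous).isBounded.subset_closedBall (0, 0)
    have ht := (hΦ.tame_fst (k := k) fun x => hR ⟨x, rfl⟩).finite (min u.1 u.2)
    have e : {x | TopCorr.diagFst Φ x ≤ u} = sublevel (fun x => (Φ x).1) (min u.1 u.2) :=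
      Set.ext fun x => (le_min_iff (c := (Φ x).1)).symm
    rw [← e] at ht
    exact ht

theorem Admissible.diagSnd [CompactSpace X] (hΦ : Admissible 𝕂 Φ) :
    Admissible 𝕂 (diagSnd Φ) where
  continuous := hΦ.continuous.snd.prodMk hΦ.continuous.snd
  finite k u := by
    obtain ⟨R, hR⟩ := (isCompact_range hΦ.continuous).isBounded.subset_closedBall (0, 0)
    have ht := (hΦ.tame_snd (k := k) fun x => hR ⟨x, rfl⟩).finite (min u.1 u.2)
    have e : {x | TopCorr.diagSnd Φ x ≤ u} = sublevel (fun x => (Φ x).2) (min u.1 u.2) :=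
      Set.ext fun x => (le_min_iff (c := (Φ x).2)).symm
    rw [← e] at ht
    exact ht

theorem FinitelyTriangulable.compactSpace (hX : FinitelyTriangulable X) : CompactSpace X := by
  obtain ⟨n, K, hK, ⟨e⟩⟩ := hX
  have : IsCompact K.space :=
    hK.isCompact_biUnion fun s _ => s.finite_toSet.isCompact_convexHull ℝ
  have := isCompact_iff_compactSpace.1 this
  exact e.symm.compactSpace

end Lines

/-! ### The matching distance -/

section MatchDist

variable {𝕂 : Type*} [Field 𝕂] (k : ℕ) {X : Type*} [TopologicalSpace X] {Φ Ψ : X → ℝ × ℝ}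

theorem exists_dist_le [CompactSpace X] (hΦ : Continuous Φ) (hΨ : Continuous Ψ) :
    ∃ R, 0 ≤ R ∧ (∀ x, dist (Φ x) 0 ≤ R) ∧ ∀ x, dist (Ψ x) 0 ≤ R := by
  obtain ⟨R, hR⟩ := (isCompact_range hΦ).isBounded.subset_closedBall 0
  obtain ⟨R', hR'⟩ := (isCompact_range hΨ).isBounded.subset_closedBall 0
  exact ⟨max (max R R') 0, le_max_right _ _,
    fun x => (hR ⟨x, rfl⟩).trans ((le_max_left _ _).trans (le_max_left _ _)),
    fun x => (hR' ⟨x, rfl⟩).trans ((le_max_right _ _).trans (le_max_left _ _))⟩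

theorem matchDist_ne_top [CompactSpace X] (hΦ : Admissible 𝕂 Φ) (hΨ : Admissible 𝕂 Ψ) :
    matchDist 𝕂 k Φ Ψ ≠ ⊤ := by
  obtain ⟨R, h0, hR, hR'⟩ := exists_dist_le hΦ.continuous hΨ.continuous
  refine ne_top_of_le_ne_top (ENNReal.ofReal_ne_top (r := 2 * R)) ?_
  refine iSup_le fun a => iSup_le fun ha => iSup_le fun b => ?_
  refine (bottleneck_le_sub (hΦ.tame_lineFiltration hR ha b) (hΨ.tame_lineFiltration hR' ha b)
    (by linarith)).trans (ENNReal.ofReal_le_ofReal (by linarith))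

/-- Along the vertical line far to the left, the filtrations are those of the first components up
to a translation. -/
theorem bottleneck_fst_le_matchDist [CompactSpace X] (hΦ : Continuous Φ) (hΨ : Continuous Ψ) :
    bottleneck 𝕂 k (fun x => (Φ x).1) (fun x => (Ψ x).1) ≤ matchDist 𝕂 k Φ Ψ := by
  obtain ⟨R, -, hR, hR'⟩ := exists_dist_le hΦ hΨ
  have key {Θ : X → ℝ × ℝ} (h : ∀ x, dist (Θ x) 0 ≤ R) :
      lineFiltration Θ 0 (-R) = fun x => (Θ x).1 + R := by
    funext x
    have := (abs_sub_le_iff.1 ((le_max_left _ _ : dist (Θ x).1 (0 : ℝ) ≤ _).trans (h x))).2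
    rw [lineFiltration, if_pos rfl, max_eq_left (by linarith), sub_neg_eq_add]
  refine (bottleneck_le_add_const 𝕂 k _ _ R).trans ?_
  rw [← key hR, ← key hR']
  exact le_iSup₂_of_le (0 : ℝ) (by simp) (le_iSup_of_le (-R) le_rfl)

/-- Along the horizontal line far below, the filtrations are those of the second components up to a
translation. -/
theorem bottleneck_snd_le_matchDist [CompactSpace X] (hΦ : Continuous Φ) (hΨ : Continuous Ψ) :
    bottleneck 𝕂 k (fun x => (Φ x).2) (fun x => (Ψ x).2) ≤ matchDist 𝕂 k Φ Ψ := by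
  obtain ⟨R, -, hR, hR'⟩ := exists_dist_le hΦ hΨ
  have key {Θ : X → ℝ × ℝ} (h : ∀ x, dist (Θ x) 0 ≤ R) :
      lineFiltration Θ 1 R = fun x => (Θ x).2 + R := by
    funext x
    have := (abs_sub_le_iff.1 ((le_max_right _ _ : dist (Θ x).2 (0 : ℝ) ≤ _).trans (h x))).2
    rw [lineFiltration, if_neg one_ne_zero, if_pos rfl, max_eq_right (by linarith)]
  refine (bottleneck_le_add_const 𝕂 k _ _ R).trans ?_
  rw [← key hR, ← key hR']
  exact le_iSup₂_of_le (1 : ℝ) (by simp) (le_iSup_of_le R le_rfl)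

theorem topDiff_nonneg [CompactSpace X] (hΦ : Admissible 𝕂 Φ) (hΨ : Admissible 𝕂 Ψ) :
    0 ≤ topDiff 𝕂 k Φ Ψ :=
  sub_nonneg.2 (max_le
    (ENNReal.toReal_mono (matchDist_ne_top k hΦ hΨ)
      (bottleneck_fst_le_matchDist k hΦ.continuous hΨ.continuous))
    (ENNReal.toReal_mono (matchDist_ne_top k hΦ hΨ)
      (bottleneck_snd_le_matchDist k hΦ.continuous hΨ.continuous)))

end MatchDist

/-! ### The topological correlation -/

section Correlation

variable (𝕂 : Type*) [Field 𝕂] (k : ℕ) {X : Type*} [TopologicalSpace X]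

theorem topDiff_self (Φ : X → ℝ × ℝ) : topDiff 𝕂 k Φ Φ = 0 := by
  simp [topDiff, matchDist, bottleneck_self]

theorem topCorr_diagonal (f : X → ℝ) : topCorr 𝕂 k (fun x => (f x, f x)) = 1 := by
  have h : topDiff 𝕂 k (fun x => (f x, f x)) (diagFst fun x => (f x, f x)) +
      topDiff 𝕂 k (fun x => (f x, f x)) (diagSnd fun x => (f x, f x)) = 0 := by
    change topDiff 𝕂 k (fun x => (f x, f x)) (fun x => (f x, f x)) +
      topDiff 𝕂 k (fun x => (f x, f x)) (fun x => (f x, f x)) = 0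
    rw [topDiff_self, add_zero]
  exact if_neg (not_not.2 h)

theorem topDiff_diagFst (f g : X → ℝ) :
    topDiff 𝕂 k (fun x => (f x, g x)) (fun x => (f x, f x)) =
      (matchDist 𝕂 k (fun x => (f x, g x)) (fun x => (f x, f x))).toReal -
        (bottleneck 𝕂 k f g).toReal := by
  simp only [topDiff, bottleneck_self, ENNReal.toReal_zero]
  rw [bottleneck_comm (φ := fun x => g x), max_eq_right ENNReal.toReal_nonneg]

theorem topDiff_diagSnd (f g : X → ℝ) :
    topDiff 𝕂 k (fun x => (f x, g x)) (fun x => (g x, g x)) =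
      (matchDist 𝕂 k (fun x => (f x, g x)) (fun x => (g x, g x))).toReal -
        (bottleneck 𝕂 k f g).toReal := by
  simp only [topDiff, bottleneck_self, ENNReal.toReal_zero]
  rw [max_eq_left ENNReal.toReal_nonneg]

variable {𝕂} {Φ : X → ℝ × ℝ}

theorem topCorr_mem_Icc [CompactSpace X] (hΦ : Admissible 𝕂 Φ) :
    topCorr 𝕂 k Φ ∈ Set.Icc (0 : ℝ) 1 := by
  have h1 := topDiff_nonneg k hΦ hΦ.diagFst
  have h2 := topDiff_nonneg k hΦ hΦ.diagSnd
  unfold topCorr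
  generalize topDiff 𝕂 k Φ (diagFst Φ) = s at *
  generalize topDiff 𝕂 k Φ (diagSnd Φ) = t at *
  split_ifs with h
  · have hst : 0 < s + t := lt_of_le_of_ne (add_nonneg h1 h2) (Ne.symm h)
    have := le_max_left s t
    have := le_max_right s t
    exact ⟨sub_nonneg.2 ((one_le_div hst).2 (by linarith)), by
      rw [sub_le_iff_le_add, div_le_iff₀ hst]
      linarith [max_le (le_add_of_nonneg_right h2) (le_add_of_nonneg_left h1)]⟩
  · simp

theorem topCorr_eq_zero_iff [CompactSpace X] (hΦ : Admissible 𝕂 Φ) :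
    topCorr 𝕂 k Φ = 0 ↔ topDiff 𝕂 k Φ (diagFst Φ) = topDiff 𝕂 k Φ (diagSnd Φ) ∧
      topDiff 𝕂 k Φ (diagSnd Φ) ≠ 0 := by
  have h1 := topDiff_nonneg k hΦ hΦ.diagFst
  have h2 := topDiff_nonneg k hΦ hΦ.diagSnd
  unfold topCorr
  generalize topDiff 𝕂 k Φ (diagFst Φ) = s at *
  generalize topDiff 𝕂 k Φ (diagSnd Φ) = t at *
  split_ifs with h
  · rw [sub_eq_zero, div_eq_one_iff_eq h]
    constructor
    · intro hm
      have hs := le_max_left s t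
      have ht := le_max_right s t
      obtain rfl : s = t := by linarith
      exact ⟨rfl, fun h0 => h (by rw [h0, add_zero])⟩
    · rintro ⟨rfl, -⟩
      rw [max_self, two_mul]
  · rw [not_not] at h
    exact ⟨fun h' => absurd h' one_ne_zero, fun h' => absurd (by linarith : t = 0) h'.2⟩

theorem topCorr_eq_one_iff [CompactSpace X] (hΦ : Admissible 𝕂 Φ) :
    topCorr 𝕂 k Φ = 1 ↔ topDiff 𝕂 k Φ (diagFst Φ) = 0 ∨ topDiff 𝕂 k Φ (diagSnd Φ) = 0 := by
  have h1 := topDiff_nonneg k hΦ hΦ.diagFst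
  have h2 := topDiff_nonneg k hΦ hΦ.diagSnd
  unfold topCorr
  generalize topDiff 𝕂 k Φ (diagFst Φ) = s at *
  generalize topDiff 𝕂 k Φ (diagSnd Φ) = t at *
  split_ifs with h
  · rw [sub_eq_iff_eq_add, div_eq_iff h]
    rcases le_total s t with hst | hst
    · rw [max_eq_right hst]
      exact ⟨fun h' => .inl (by linarith), fun h' => by rcases h' with rfl | rfl <;> linarith⟩
    · rw [max_eq_left hst]
      exact ⟨fun h' => .inr (by linarith), fun h' => by rcases h' with rfl | rfl <;> linarith⟩
  · rw [not_not] at h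
    exact ⟨fun _ => .inl (by linarith), fun _ => rfl⟩

theorem topCorr_eq_one_iff_matchDist [CompactSpace X] {f g : X → ℝ}
    (h : Admissible 𝕂 fun x => (f x, g x)) :
    topCorr 𝕂 k (fun x => (f x, g x)) = 1 ↔
      matchDist 𝕂 k (fun x => (f x, g x)) (fun x => (f x, f x)) = bottleneck 𝕂 k f g ∨
        matchDist 𝕂 k (fun x => (f x, g x)) (fun x => (g x, g x)) = bottleneck 𝕂 k f g := by
  have hF : matchDist 𝕂 k (fun x => (f x, g x)) (fun x => (f x, f x)) ≠ ⊤ :=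
    matchDist_ne_top k h h.diagFst
  have hG : matchDist 𝕂 k (fun x => (f x, g x)) (fun x => (g x, g x)) ≠ ⊤ :=
    matchDist_ne_top k h h.diagSnd
  have hB : bottleneck 𝕂 k f g ≠ ⊤ := ne_top_of_le_ne_top hG
    (bottleneck_fst_le_matchDist (Φ := fun x => (f x, g x)) (Ψ := fun x => (g x, g x)) k
      h.continuous h.diagSnd.continuous)
  rw [← ENNReal.toReal_eq_toReal_iff' hF hB, ← ENNReal.toReal_eq_toReal_iff' hG hB]
  have eF := topDiff_diagFst 𝕂 k f g
  have eG := topDiff_diagSnd 𝕂 k f g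
  refine (topCorr_eq_one_iff k h).trans (or_congr ?_ ?_)
  · exact (iff_of_eq (congrArg (· = 0) eF)).trans sub_eq_zero
  · exact (iff_of_eq (congrArg (· = 0) eG)).trans sub_eq_zero

end Correlation

/-! ### Čech homology in degree zero and of finite discrete spaces -/

section DegreeZero

variable {𝕂 : Type*} [Field 𝕂] {X Y : Type*} [TopologicalSpace X] [TopologicalSpace Y]

/-- The chain consisting of a single simplex. -/
noncomputable def simplexChain (𝕂 : Type*) [Field 𝕂] {U : FinOpenCover X} {k : ℕ}
    (s : NerveSimplex U k) : NerveChain 𝕂 U k :=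
  Finsupp.single s 1

/-- A member of a cover with a given point, as a vertex of the nerve. -/
def vertex {U : FinOpenCover X} {x : X} (i : Fin U.n) (hi : x ∈ U.U i) : NerveSimplex U 0 :=
  ⟨fun _ => i, x, fun _ => hi⟩

/-- The class in degree zero of a vertex of the nerve. -/
noncomputable def vertexClass (𝕂 : Type*) [Field 𝕂] {U : FinOpenCover X} {x : X} (i : Fin U.n)
    (hi : x ∈ U.U i) : NerveHomology 𝕂 0 U :=
  Submodule.Quotient.mk ⟨simplexChain 𝕂 (vertex i hi), Submodule.mem_top⟩

theorem pushChain_simplexChain {U : FinOpenCover X} {V : FinOpenCover Y} {k l : ℕ}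
    (m : NerveSimplex U k → NerveSimplex V l) (s : NerveSimplex U k) :
    pushChain 𝕂 m (simplexChain 𝕂 s) = simplexChain 𝕂 (m s) :=
  Finsupp.mapDomain_single

theorem boundary_zero_apply {U : FinOpenCover X} (c : NerveChain 𝕂 U 1) :
    boundary 𝕂 U 0 c =
      pushChain 𝕂 (NerveSimplex.face 0) c - pushChain 𝕂 (NerveSimplex.face 1) c := by
  rw [boundary, Fin.sum_univ_two]
  simp [sub_eq_add_neg]

/-- Two vertices whose members of the cover have a common point are joined by an edge. -/
theorem vertexClass_eq {U : FinOpenCover X} {x : X} {i j : Fin U.n} (hi : x ∈ U.U i)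
    (hj : x ∈ U.U j) : vertexClass 𝕂 i hi = vertexClass 𝕂 j hj := by
  refine (Submodule.Quotient.eq _).2 ?_
  let s : NerveSimplex U 1 := ⟨![j, i], x, fun l => by fin_cases l <;> assumption⟩
  have h0 : s.face 0 = vertex i hi := Subtype.ext (funext fun l => by fin_cases l; rfl)
  have h1 : s.face 1 = vertex j hj := Subtype.ext (funext fun l => by fin_cases l; rfl)
  refine ⟨simplexChain 𝕂 s, ?_⟩
  rw [boundary_zero_apply, pushChain_simplexChain, pushChain_simplexChain, h0, h1]
  rfl

theorem nerveMap_vertexClass {f : X → Y} {U : FinOpenCover X} {V : FinOpenCover Y}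
    {p : Fin U.n → Fin V.n} (h : Carries f U V p) {x : X} {i : Fin U.n} (hi : x ∈ U.U i) :
    nerveMap 𝕂 h 0 (vertexClass 𝕂 i hi) = vertexClass 𝕂 (p i) (h i x hi) := by
  refine congrArg (Submodule.Quotient.mk (p := boundaries 𝕂 V 0)) (Subtype.ext ?_)
  exact pushChain_simplexChain _ _

/-- The sum of the coefficients of a chain. -/
noncomputable def augmentation (𝕂 : Type*) [Field 𝕂] (U : FinOpenCover X) (k : ℕ) :
    NerveChain 𝕂 U k →ₗ[𝕂] 𝕂 :=
  Finsupp.linearCombination 𝕂 fun _ => (1 : 𝕂)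

theorem augmentation_pushChain {U : FinOpenCover X} {V : FinOpenCover Y} {k l : ℕ}
    (m : NerveSimplex U k → NerveSimplex V l) (c : NerveChain 𝕂 U k) :
    augmentation 𝕂 V l (pushChain 𝕂 m c) = augmentation 𝕂 U k c :=
  Finsupp.linearCombination_mapDomain 𝕂 m c

theorem augmentation_simplexChain {U : FinOpenCover X} {k : ℕ} (s : NerveSimplex U k) :
    augmentation 𝕂 U k (simplexChain 𝕂 s) = 1 :=
  (Finsupp.linearCombination_single 𝕂 1 s).trans (one_smul 𝕂 1)

theorem vertexClass_ne_zero {U : FinOpenCover X} {x : X} {i : Fin U.n} (hi : x ∈ U.U i) :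
    vertexClass 𝕂 i hi ≠ 0 := by
  intro h
  obtain ⟨c, hc⟩ := (Submodule.Quotient.mk_eq_zero _).1 h
  have h1 : augmentation 𝕂 U 0 (boundary 𝕂 U 0 c) = 1 := by
    rw [hc]
    exact augmentation_simplexChain _
  rw [boundary_zero_apply, map_sub, augmentation_pushChain, augmentation_pushChain,
    sub_self] at h1
  exact zero_ne_one h1

/-- The class in degree zero of a point. -/
noncomputable def pointClass (𝕂 : Type*) [Field 𝕂] (x : X) : CechHomology 𝕂 0 X :=
  ⟨fun U => vertexClass 𝕂 (U.covers x).choose (U.covers x).choose_spec, fun U V p h => by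
    rw [nerveMap_vertexClass]
    exact vertexClass_eq _ _⟩

theorem finrank_range_ne_zero {V W : Type*} [AddCommGroup V] [Module 𝕂 V] [AddCommGroup W]
    [Module 𝕂 W] [Module.Finite 𝕂 V] {q : V →ₗ[𝕂] W} {x : V} (hx : q x ≠ 0) :
    Module.finrank 𝕂 (LinearMap.range q) ≠ 0 := fun h => by
  have h' := LinearMap.range_eq_bot.1 (Submodule.finrank_eq_zero.1 h)
  exact hx (by rw [h', LinearMap.zero_apply])

theorem inclRank_zero_ne_zero {A B : Set X} (h : A ⊆ B) (hA : A.Nonempty)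
    [Module.Finite 𝕂 (CechHomology 𝕂 0 A)] : inclRank 𝕂 0 h ≠ 0 := by
  obtain ⟨x, hx⟩ := hA
  let V : FinOpenCover B := ⟨1, fun _ => Set.univ, fun _ => isOpen_univ, fun _ => ⟨0, trivial⟩⟩
  let y : A := ⟨x, hx⟩
  let f : C(A, B) := ContinuousMap.inclusion h
  have hne : cechMap 𝕂 0 f (pointClass 𝕂 y) ≠ 0 := fun h0 => by
    have h1 : nerveMap 𝕂 (carries_comap f V) 0 (vertexClass 𝕂 ((V.comap f).covers y).choose
        ((V.comap f).covers y).choose_spec) = 0 :=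
      congrArg (fun z : CechHomology 𝕂 0 B => z.1 V) h0
    rw [nerveMap_vertexClass] at h1
    exact vertexClass_ne_zero _ h1
  exact finrank_range_ne_zero (V := CechHomology 𝕂 0 A) (W := CechHomology 𝕂 0 B) hne

/-- In degree zero a class at infinity is born at the minimum of the function. -/
theorem Tame.essentialMult_ne_zero {φ : X → ℝ} {m M : ℝ} (hφ : Tame 𝕂 0 φ m M) {x : X}
    (hx : φ x = m) : essentialMult 𝕂 0 φ m ≠ 0 := by
  obtain ⟨ε, hε, he, -⟩ := hφ.exists_essentialMult_eq m
  have := hφ.finite (m + ε)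
  have h : sublevelRank 𝕂 0 φ (m + ε) ≠ 0 :=
    inclRank_zero_ne_zero _ ⟨x, show φ x ≤ m + ε by linarith⟩
  rw [he, hφ.sublevelRank_eq_zero (show m - ε < m by linarith)]
  exact h

end DegreeZero

section Discrete

variable (𝕂 : Type*) [Field 𝕂] (X : Type*) [TopologicalSpace X] [Finite X] [DiscreteTopology X]

/-- The cover by singletons refines every other cover, so that the Čech homology embeds into the
homology of its nerve. -/
instance finite_cechHomology_of_discrete (k : ℕ) : Module.Finite 𝕂 (CechHomology 𝕂 k X) := by
  let e := Finite.equivFin X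
  let U : FinOpenCover X :=
    ⟨Nat.card X, fun i => {e.symm i}, fun _ => isOpen_discrete _, fun x => ⟨e x, by simp⟩⟩
  have hs : Finite (NerveSimplex U k) :=
    inferInstanceAs (Finite {s : Fin (k + 1) → Fin U.n // ∃ x, ∀ j, x ∈ U.U (s j)})
  have hc : Module.Finite 𝕂 (NerveChain 𝕂 U k) :=
    inferInstanceAs (Module.Finite 𝕂 (NerveSimplex U k →₀ 𝕂))
  let π : CechHomology 𝕂 k X →ₗ[𝕂] NerveHomology 𝕂 k U :=
    (LinearMap.proj U).comp (CechHomology 𝕂 k X).subtype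
  refine Module.Finite.of_injective π fun x y hxy => Subtype.ext (funext fun V => ?_)
  have hxy' : x.1 U = y.1 U := hxy
  choose p hp using V.covers
  have h : Carries id U V fun i => p (e.symm i) := fun i x hx => by
    obtain rfl : x = e.symm i := hx
    exact hp _
  rw [← x.2 U V _ h, ← y.2 U V _ h, hxy']

theorem finitelyTriangulable_of_discrete : FinitelyTriangulable X := by
  let v : X → EuclideanSpace ℝ (Fin 1) := fun x =>
    EuclideanSpace.single 0 ((Finite.equivFin X x : ℕ) : ℝ)
  have hv : Function.Injective v := fun x y h => by
    have h0 := congrArg (fun z : EuclideanSpace ℝ (Fin 1) => z 0) h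
    simpa [v, Fin.val_inj] using h0
  let K : Geometry.SimplicialComplex ℝ (EuclideanSpace ℝ (Fin 1)) :=
    { faces := Set.range fun x => {v x}
      isRelLowerSet_faces := by
        rintro _ ⟨x, rfl⟩
        refine ⟨Finset.singleton_nonempty _, fun t ht hne => ⟨x, ?_⟩⟩
        exact ((Finset.subset_singleton_iff.1 ht).resolve_left hne.ne_empty).symm
      indep := by
        rintro _ ⟨x, rfl⟩
        have : Subsingleton ({v x} : Finset (EuclideanSpace ℝ (Fin 1))) := by
          refine ⟨fun a b => Subtype.ext ?_⟩
          rw [Finset.mem_singleton.1 a.2, Finset.mem_singleton.1 b.2]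
        exact affineIndependent_of_subsingleton ℝ _
      inter_subset_convexHull := by
        rintro _ _ ⟨x, rfl⟩ ⟨y, rfl⟩
        simp only [Finset.coe_singleton, convexHull_singleton]
        exact subset_convexHull ℝ _ }
  have hK : K.space = Set.range v := by
    ext z
    simp [Geometry.SimplicialComplex.space, K, eq_comm]
  refine ⟨1, K, Set.finite_range _, ?_⟩
  rw [hK]
  have : DiscreteTopology (Set.range v) := inferInstance
  exact ⟨(Equiv.ofInjective v hv).toHomeomorphOfDiscrete⟩

end Discrete

/-! ### Two points with different matching distances to the two diagonal bifiltrations -/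

section Example

variable (𝕂 : Type*) [Field 𝕂]

/-- The function with values `1` and `2` on the two-point space. -/
def exampleFst (x : Bool) : ℝ := if x then 2 else 1

/-- The function with values `2` and `0` on the two-point space. -/
def exampleSnd (x : Bool) : ℝ := if x then 0 else 2

theorem admissible_of_discrete {X : Type*} [TopologicalSpace X] [Finite X] [DiscreteTopology X]
    (Φ : X → ℝ × ℝ) : Admissible 𝕂 Φ :=
  ⟨continuous_of_discreteTopology, fun _ _ => inferInstance⟩

theorem dist_example_le (x : Bool) :
    dist (exampleFst x, exampleSnd x) (1, 1) ≤ 1 ∧ dist (exampleFst x, exampleFst x) (1, 1) ≤ 1 ∧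
      dist (exampleSnd x, exampleSnd x) (1, 1) ≤ 1 := by
  cases x <;> norm_num [Prod.dist_eq, Real.dist_eq, exampleFst, exampleSnd]

theorem one_le_bottleneck_example : 1 ≤ bottleneck 𝕂 0 exampleFst exampleSnd := by
  have h := admissible_of_discrete 𝕂 fun x => (exampleFst x, exampleSnd x)
  have hf : Tame 𝕂 0 exampleFst _ _ := h.tame_fst fun x => (dist_example_le x).1
  have hg : Tame 𝕂 0 exampleSnd _ _ := h.tame_snd fun x => (dist_example_le x).1
  have hf' : Tame 𝕂 0 exampleFst ((1 - 1) + 1) (1 + 1) :=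
    ⟨fun x => by cases x <;> norm_num [exampleFst], hf.upper, hf.finite⟩
  rw [← ENNReal.ofReal_one]
  exact le_bottleneck hf' (hg.essentialMult_ne_zero (x := true) (by norm_num [exampleSnd]))

/-- Exchanging the two points moves `(f, g)` by at most `1` to `(f, f)`. -/
theorem matchDist_example_fst_le : matchDist 𝕂 0 (fun x => (exampleFst x, exampleSnd x))
    (fun x => (exampleFst x, exampleFst x)) ≤ 1 := by
  refine iSup_le fun a => iSup_le fun ha => iSup_le fun b => ?_
  have h := (admissible_of_discrete 𝕂 fun x => (exampleFst x, exampleSnd x)).tame_lineFiltration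
    (k := 0) (fun x => (dist_example_le x).1) ha b
  have h' := (admissible_of_discrete 𝕂 fun x => (exampleFst x, exampleFst x)).tame_lineFiltration
    (k := 0) (fun x => (dist_example_le x).2.1) ha b
  let s : Bool ≃ₜ Bool := Equiv.boolNot.toHomeomorphOfDiscrete
  have hs (x : Bool) :
      dist (exampleFst (!x), exampleFst (!x)) (exampleFst x, exampleSnd x) ≤ 1 := by
    cases x <;> norm_num [Prod.dist_eq, Real.dist_eq, exampleFst, exampleSnd]
  have hs' (x : Bool) :
      dist (exampleFst (!x), exampleSnd (!x)) (exampleFst x, exampleFst x) ≤ 1 := by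
    cases x <;> norm_num [Prod.dist_eq, Real.dist_eq, exampleFst, exampleSnd]
  rw [← ENNReal.ofReal_one]
  refine bottleneck_le h h' (by linarith) (by linarith) ?_ ?_
  · exact h'.sublevelRank_le_of_homeomorph s fun x =>
      (lineFun_le_add_dist ha b _ (exampleFst x, exampleSnd x)).trans (add_le_add le_rfl (hs x))
  · exact h.sublevelRank_le_of_homeomorph s fun x =>
      (lineFun_le_add_dist ha b _ (exampleFst x, exampleFst x)).trans (add_le_add le_rfl (hs' x))

/-- Along the diagonal, `(f, g)` takes the value `2` at both points, whereas `(g, g)` takes the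
values `2` and `0`. -/
theorem two_le_matchDist_example_snd : 2 ≤ matchDist 𝕂 0
    (fun x => (exampleFst x, exampleSnd x)) (fun x => (exampleSnd x, exampleSnd x)) := by
  have ha : (1 / 2 : ℝ) ∈ Set.Icc (0 : ℝ) 1 := by norm_num
  have h := (admissible_of_discrete 𝕂 fun x => (exampleFst x, exampleSnd x)).tame_lineFiltration
    (k := 0) (fun x => (dist_example_le x).1) ha 0
  have h' := (admissible_of_discrete 𝕂 fun x => (exampleSnd x, exampleSnd x)).tame_lineFiltration
    (k := 0) (fun x => (dist_example_le x).2.2) ha 0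
  have e : lineFun (1 / 2) 0 (1, 1) = 1 := by norm_num [lineFun]
  rw [e] at h h'
  have hΦ := Tame.mk (m := (1 - 1) + 2) (fun x => by
    cases x <;> norm_num [lineFiltration, exampleFst, exampleSnd]) h.upper h.finite
  have hG := h'.essentialMult_ne_zero (x := true) (by norm_num [lineFiltration, exampleSnd])
  rw [← ENNReal.ofReal_ofNat]
  exact (le_bottleneck hΦ hG).trans (le_iSup₂_of_le (1 / 2) ha (le_iSup_of_le 0 le_rfl))

theorem matchDist_example_fst : matchDist 𝕂 0 (fun x => (exampleFst x, exampleSnd x))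
    (fun x => (exampleFst x, exampleFst x)) = bottleneck 𝕂 0 exampleFst exampleSnd := by
  refine le_antisymm ((matchDist_example_fst_le 𝕂).trans (one_le_bottleneck_example 𝕂)) ?_
  rw [bottleneck_comm]
  exact bottleneck_snd_le_matchDist (Φ := fun x => (exampleFst x, exampleSnd x))
    (Ψ := fun x => (exampleFst x, exampleFst x)) 0 continuous_of_discreteTopology
    continuous_of_discreteTopology

theorem matchDist_example_snd_ne : matchDist 𝕂 0 (fun x => (exampleFst x, exampleSnd x))
    (fun x => (exampleSnd x, exampleSnd x)) ≠ bottleneck 𝕂 0 exampleFst exampleSnd := by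
  rw [← matchDist_example_fst]
  refine ne_of_gt (lt_of_le_of_lt (matchDist_example_fst_le 𝕂)
    (lt_of_lt_of_le ?_ (two_le_matchDist_example_snd 𝕂)))
  norm_num

end Example

end TopCorr

theorem mainTheorem1 (𝕂 : Type*) [Field 𝕂] :
    (∀ (k : ℕ) (X : Type*) [TopologicalSpace X], TopCorr.FinitelyTriangulable X →
      (∀ Φ Ψ : X → ℝ × ℝ, TopCorr.Admissible 𝕂 Φ → TopCorr.Admissible 𝕂 Ψ →
        TopCorr.bottleneck 𝕂 k (fun x => (Φ x).1) (fun x => (Ψ x).1) ≠ ⊤ ∧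
        TopCorr.bottleneck 𝕂 k (fun x => (Φ x).2) (fun x => (Ψ x).2) ≠ ⊤ ∧
        TopCorr.matchDist 𝕂 k Φ Ψ ≠ ⊤ ∧
        0 ≤ TopCorr.topDiff 𝕂 k Φ Ψ) ∧
      (∀ f : X → ℝ, TopCorr.Admissible 𝕂 (fun x => (f x, f x)) →
        TopCorr.topCorr 𝕂 k (fun x => (f x, f x)) = 1) ∧
      (∀ f g : X → ℝ, TopCorr.Admissible 𝕂 (fun x => (f x, g x)) →
        let Φ : X → ℝ × ℝ := fun x => (f x, g x)
        let F : X → ℝ × ℝ := fun x => (f x, f x)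
        let G : X → ℝ × ℝ := fun x => (g x, g x)
        TopCorr.topCorr 𝕂 k Φ ∈ Set.Icc (0 : ℝ) 1 ∧
        (TopCorr.topCorr 𝕂 k Φ = 0 ↔
          TopCorr.topDiff 𝕂 k Φ F = TopCorr.topDiff 𝕂 k Φ G ∧
            TopCorr.topDiff 𝕂 k Φ G ≠ 0) ∧
        (TopCorr.matchDist 𝕂 k Φ F = TopCorr.bottleneck 𝕂 k f g ∧
            TopCorr.bottleneck 𝕂 k f g = TopCorr.matchDist 𝕂 k Φ G →
          TopCorr.topCorr 𝕂 k Φ = 1) ∧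
        (TopCorr.topCorr 𝕂 k Φ = 1 ↔
          TopCorr.matchDist 𝕂 k Φ F = TopCorr.bottleneck 𝕂 k f g ∨
            TopCorr.matchDist 𝕂 k Φ G = TopCorr.bottleneck 𝕂 k f g))) ∧
    (∃ (X : Type) (_ : TopologicalSpace X) (f g : X → ℝ),
      TopCorr.FinitelyTriangulable X ∧ TopCorr.Admissible 𝕂 (fun x => (f x, g x)) ∧
      TopCorr.topCorr 𝕂 0 (fun x => (f x, g x)) = 1 ∧
      TopCorr.matchDist 𝕂 0 (fun x => (f x, g x)) (fun x => (f x, f x)) =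
        TopCorr.bottleneck 𝕂 0 f g ∧
      TopCorr.matchDist 𝕂 0 (fun x => (f x, g x)) (fun x => (g x, g x)) ≠
        TopCorr.bottleneck 𝕂 0 f g) := by
  refine ⟨fun k X _ hX => ?_, Bool, inferInstance, TopCorr.exampleFst, TopCorr.exampleSnd,
    TopCorr.finitelyTriangulable_of_discrete Bool, TopCorr.admissible_of_discrete 𝕂 _, ?_,
    TopCorr.matchDist_example_fst 𝕂, TopCorr.matchDist_example_snd_ne 𝕂⟩
  · have := hX.compactSpace
    refine ⟨fun Φ Ψ hΦ hΨ => ?_, fun f _ => TopCorr.topCorr_diagonal 𝕂 k f, fun f g h => ?_⟩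
    · have hm := TopCorr.matchDist_ne_top k hΦ hΨ
      exact ⟨ne_top_of_le_ne_top hm
          (TopCorr.bottleneck_fst_le_matchDist k hΦ.continuous hΨ.continuous),
        ne_top_of_le_ne_top hm
          (TopCorr.bottleneck_snd_le_matchDist k hΦ.continuous hΨ.continuous),
        hm, TopCorr.topDiff_nonneg k hΦ hΨ⟩
    · have h1 := TopCorr.topCorr_eq_one_iff_matchDist k h
      exact ⟨TopCorr.topCorr_mem_Icc k h, TopCorr.topCorr_eq_zero_iff k h,
        fun hd => h1.2 (.inl hd.1), h1⟩
  · exact (TopCorr.topCorr_eq_one_iff_matchDist 0 (TopCorr.admissible_of_discrete 𝕂 _)).2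
      (.inl (TopCorr.matchDist_example_fst 𝕂))
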